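/- **Conventions.** A mixed polynomial in $n$ complex variables is a function $f(\mathbf z,\bar{\mathbf z})=\sum_{\nu,\mu}c_{\nu,\mu}\mathbf z^\nu\bar{\mathbf z}^\mu$ (finite sum, $\nu,\mu\in\mathbb N^n$). Identify $\mathbb C^n$ with $\mathbb R^{2n}$. A point $\mathbf z$ is a *critical point* of $f$ if the real differentials of $\Re f$ and $\Im f$ at $\mathbf z$ are linearly dependent over $\mathbb R$. The *Newton polygon* $\Gamma_+(f)$ is the convex hull of $\bigcup_{c_{\nu,\mu}\ne0}\bigl((\nu+\mu)+\mathbb R_+^n\bigr)$, and the *Newton boundary* $\Gamma(f)$ is the union of its compact faces. For a face $\Delta$ put $f_\Delta:=\sum_{\nu+\mu\in\Delta}c_{\nu,\mu}\mathbf z^\nu\bar{\mathbf z}^\mu$. The function $f$ is *strongly non-degenerate* if for each compact face $\Delta$ of $\Gamma_+(f)$, $f_\Delta$ has no critical point in $(\mathbb C^*)^n$. For $I\subseteq\{1,\dots,n\}$ let $\mathbb C^I=\{\mathbf z\in\mathbb C^n: z_i=0\text{ for }i\notin I\}$; it is a *vanishing coordinate subspace* of $f$ if $f|_{\mathbb C^I}\equiv0$.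 A non-compact face $\Delta$ of $\Gamma_+(f)$ is *essential* if there is $\mathbf w\in\mathbb N^n\setminus\{\mathbf 0\}$ such that, with $I_{\mathbf w}:=\{i: w_i=0\}$: (i) $\Delta$ is the set of points of $\Gamma_+(f)$ where $\xi\mapsto\sum_i w_i\xi_i$ takes its minimal value on $\Gamma_+(f)$; (ii) $f|_{\mathbb C^{I_{\mathbf w}}}\equiv0$; (iii) $\alpha+\mathbb R_+\mathbf e_i\subseteq\Delta$ for all $\alpha\in\Delta$ and $i\in I_{\mathbf w}$. The set $I_\Delta:=I_{\mathbf w}$ does not depend on $\mathbf w$. For such $\Delta$, $f_\Delta$ is *locally tame* if there is $\rho>0$ such that for all $(u_i)_{i\in I_\Delta}$ in $\mathbb C^*$ with $\sum_{i\in I_\Delta}|u_i|^2<\rho^2$, $f_\Delta$ has no critical point, as a function of the variables $z_i$ with $i\notin I_\Delta$, on $\{\mathbf z\in(\mathbb C^*)^n: z_i=u_i\text{ for }i\in I_\Delta\}$. The function $f$ is *locally tame along its vanishing coordinate subspaces* if for each $I$ with $f|_{\mathbb C^I}\equiv0$ and each essential non-compact face $\Delta$ with $I_\Delta=I$, $f_\Delta$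 is locally tame. Let $B_\rho$ and $S_\rho$ be the open ball and the sphere in $\mathbb C^n$ with centre $\mathbf 0$ and radius $\rho$. For $\eta\in\mathbb C$, the set $f^{-1}(\eta)\cap B_\rho$ is *mixed non-singular* if it contains no critical point of $f$; it *meets $S_r$ transversely* if at each $\mathbf z\in f^{-1}(\eta)\cap B_\rho\cap S_r$ the real subspaces $\ker d(\Re f)(\mathbf z)\cap\ker d(\Im f)(\mathbf z)$ and $\{v\in\mathbb C^n:\Re\langle v,\mathbf z\rangle=0\}$ together span $\mathbb C^n$ over $\mathbb R$. **Proposition.** Let $f(t,\mathbf z,\bar{\mathbf z})$ be a complex polynomial in $t\in\mathbb C$, $\mathbf z$ and $\bar{\mathbf z}$ (not involving $\bar t$), and put $f_t(\mathbf z,\bar{\mathbf z}):=f(t,\mathbf z,\bar{\mathbf z})$. Suppose that for all sufficiently small $t$: $f_t(\mathbf 0)=0$ and $f_t$ is not identically zero near $\mathbf 0$; the Newton boundary $\Gamma(f_t)$ is independent of $t$; and $f_t$ is strongly non-degenerate and locally tame along its vanishing coordinate subspaces. Then there exists $R'>0$ such that for each $R''$ with $0<R''\le R'$ there are $\delta>0$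 and $\tau>0$ with the following property: for all $t$ with $|t|<\tau$, all $\eta\neq0$ with $|\eta|\le\delta$, and all $r$ with $R''\le r\le R'$, the set $f_t^{-1}(\eta)\cap B_{R'}$ is mixed non-singular and meets $S_r$ transversely. -/

import Mathlib

open Filter Topology

noncomputable section

/-- `ℂⁿ` with its Hermitian structure, and, by restriction of scalars, with the Euclidean
structure of `ℝ²ⁿ`. -/
abbrev CSpace (ι : Type) [Fintype ι] : Type := EuclideanSpace ℂ ι

/-- A mixed polynomial `∑ c_{ν,μ} z^ν z̄^μ` in `n` complex variables, as a polynomial in the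
variables `z_i` (left summand) and `z̄_i` (right summand). -/
abbrev MixedPoly (n : ℕ) : Type := MvPolynomial (Fin n ⊕ Fin n) ℂ

/-- A polynomial `f(t, z, z̄)` which does not depend on `t̄`, as a polynomial in `z, z̄` with
coefficients in `ℂ[t]`. -/
abbrev MixedFamily (n : ℕ) : Type := MvPolynomial (Fin n ⊕ Fin n) (Polynomial ℂ)

/-- The member `f_t` of the family. -/
def MixedFamily.at {n : ℕ} (F : MixedFamily n) (t : ℂ) : MixedPoly n :=
  MvPolynomial.map (Polynomial.evalRingHom t) F

/-- The point `z` is a critical point of `φ = g + √-1 h`: the real differentials `dg(z)` and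
`dh(z)` are linearly dependent over `ℝ`. -/
def IsMixedCritical {ι : Type} [Fintype ι] (φ : CSpace ι → ℂ) (z : CSpace ι) : Prop :=
  ¬ LinearIndependent ℝ
    ![fderiv ℝ (fun x => (φ x).re) z, fderiv ℝ (fun x => (φ x).im) z]

/-- The tangent space at `z` of the fibre of `φ = g + √-1 h` through `z`, when `z` is not a
critical point: the vectors killed by `dg(z)` and `dh(z)`. -/
def fibreTangent {ι : Type} [Fintype ι] (φ : CSpace ι → ℂ) (z : CSpace ι) :
    Submodule ℝ (CSpace ι) :=
  LinearMap.ker (fderiv ℝ (fun x => (φ x).re) z).toLinearMap ⊓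
    LinearMap.ker (fderiv ℝ (fun x => (φ x).im) z).toLinearMap

/-- The tangent space at `z` of the sphere centred at the origin through `z`: the vectors which
are orthogonal to `z` for the Euclidean inner product of `ℝ²ⁿ`. -/
def sphereTangent {ι : Type} [Fintype ι] (z : CSpace ι) : Submodule ℝ (CSpace ι) where
  carrier := {v | (inner ℂ z v).re = 0}
  add_mem' := by
    intro a b ha hb
    change (inner ℂ z a).re = 0 at ha
    change (inner ℂ z b).re = 0 at hb
    change (inner ℂ z (a + b)).re = 0
    rw [inner_add_right, Complex.add_re, ha, hb, add_zero]
  zero_mem' := by simp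
  smul_mem' := by
    intro c a ha
    change (inner ℂ z a).re = 0 at ha
    change (inner ℂ z (c • a)).re = 0
    rw [← Complex.coe_smul, inner_smul_right, Complex.re_ofReal_mul, ha, mul_zero]

namespace MixedPoly

variable {n : ℕ}

/-- The function `z ↦ f(z, z̄)`. -/
def toFun (f : MixedPoly n) (z : CSpace (Fin n)) : ℂ :=
  MvPolynomial.eval (Sum.elim (fun i => z i) (fun i => starRingEnd ℂ (z i))) f

/-- The point `ν + μ` of `ℝⁿ` attached to the monomial `z^ν z̄^μ`. -/
def expSum (m : (Fin n ⊕ Fin n) →₀ ℕ) : Fin n → ℝ :=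
  fun i => (m (Sum.inl i) : ℝ) + (m (Sum.inr i) : ℝ)

/-- The Newton polygon `Γ₊(f)`. -/
def newtonPolygon (f : MixedPoly n) : Set (Fin n → ℝ) :=
  convexHull ℝ (⋃ m ∈ f.support, {ξ | ∀ i, expSum m i ≤ ξ i})

/-- `Δ` is a (non-empty) compact face of the Newton polygon. -/
def IsCompactFace (f : MixedPoly n) (Δ : Set (Fin n → ℝ)) : Prop :=
  Δ.Nonempty ∧ IsExposed ℝ f.newtonPolygon Δ ∧ IsCompact Δ

/-- The Newton boundary `Γ(f)`: the union of the compact faces of the Newton polygon. -/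
def newtonBoundary (f : MixedPoly n) : Set (Fin n → ℝ) :=
  ⋃₀ {Δ | f.IsCompactFace Δ}

open Classical in
/-- The face function `f_Δ = ∑_{ν+μ ∈ Δ} c_{ν,μ} z^ν z̄^μ`. -/
def face (f : MixedPoly n) (Δ : Set (Fin n → ℝ)) : MixedPoly n :=
  ∑ m ∈ f.support.filter (fun m => expSum m ∈ Δ), MvPolynomial.monomial m (f.coeff m)

/-- For every compact face `Δ`, the face function `f_Δ` has no critical point on `(ℂ*)ⁿ`. -/
def StronglyNonDegenerate (f : MixedPoly n) : Prop :=
  ∀ Δ, f.IsCompactFace Δ →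
    ∀ z : CSpace (Fin n), (∀ i, z i ≠ 0) → ¬ IsMixedCritical (f.face Δ).toFun z

/-- `f` vanishes identically on the coordinate subspace `ℂ^I`. -/
def VanishesOn (f : MixedPoly n) (I : Finset (Fin n)) : Prop :=
  ∀ z : CSpace (Fin n), (∀ i, i ∉ I → z i = 0) → f.toFun z = 0

/-- The face `Δ_w` of the Newton polygon where `ξ ↦ ∑ w_i ξ_i` takes its minimal value. -/
def weightFace (f : MixedPoly n) (w : Fin n → ℕ) : Set (Fin n → ℝ) :=
  {ξ | ξ ∈ f.newtonPolygon ∧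
    ∀ ζ ∈ f.newtonPolygon, ∑ i, (w i : ℝ) * ξ i ≤ ∑ i, (w i : ℝ) * ζ i}

/-- `I_w = {i ; w_i = 0}`. -/
def zeroSet (w : Fin n → ℕ) : Finset (Fin n) :=
  Finset.univ.filter (fun i => w i = 0)

/-- `Δ` is a non-compact face of the Newton polygon and the weights `w` witness that it is
essential, so that its non-compact direction `I_Δ` is `zeroSet w`. -/
structure IsEssentialFace (f : MixedPoly n) (Δ : Set (Fin n → ℝ)) (w : Fin n → ℕ) : Prop where
  weight_ne_zero : w ≠ 0
  not_compact : ¬ IsCompact Δ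
  eq_face : Δ = f.weightFace w
  vanishes : f.VanishesOn (zeroSet w)
  direction : ∀ i ∈ zeroSet w, ∀ α ∈ Δ, ∀ s : ℝ, 0 ≤ s → α + s • Pi.single i (1 : ℝ) ∈ Δ

open Classical in
/-- The point with coordinates `v_i` for `i ∉ I` and `z_i` for `i ∈ I`. -/
def replaceOff (I : Finset (Fin n)) (z : CSpace (Fin n)) (v : CSpace {i : Fin n // i ∉ I}) :
    CSpace (Fin n) :=
  WithLp.toLp 2 (fun i => if h : i ∈ I then z i else v ⟨i, h⟩)

/-- `z` is a critical point of `f` as a function of the variables `z_i`, `i ∉ I`, the variables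
`z_i`, `i ∈ I`, being fixed. -/
def IsCriticalOff (f : MixedPoly n) (I : Finset (Fin n)) (z : CSpace (Fin n)) : Prop :=
  IsMixedCritical (fun v : CSpace {i : Fin n // i ∉ I} => f.toFun (replaceOff I z v))
    (WithLp.toLp 2 (fun i => z i.1))

/-- The face function `f_Δ` of an essential face with non-compact direction `I` is locally
tame. -/
def FaceLocallyTame (f : MixedPoly n) (Δ : Set (Fin n → ℝ)) (I : Finset (Fin n)) : Prop :=
  ∃ ρ : ℝ, 0 < ρ ∧ ∀ z : CSpace (Fin n), (∀ i, z i ≠ 0) →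
    ∑ i ∈ I, ‖z i‖ ^ 2 < ρ ^ 2 → ¬ (f.face Δ).IsCriticalOff I z

/-- `f` is locally tame along the coordinate subspace `ℂ^I`. -/
def LocallyTameAlong (f : MixedPoly n) (I : Finset (Fin n)) : Prop :=
  ∀ Δ w, f.IsEssentialFace Δ w → zeroSet w = I → f.FaceLocallyTame Δ I

/-- `f` is locally tame along its vanishing coordinate subspaces. -/
def LocallyTame (f : MixedPoly n) : Prop :=
  ∀ I : Finset (Fin n), f.VanishesOn I → f.LocallyTameAlong I

/-- The part of the fibre `f⁻¹(η)` in `B` is mixed non-singular: it contains no critical point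
of `f` (equivalently of `f - η`). -/
def FibreNonSingular (f : MixedPoly n) (η : ℂ) (B : Set (CSpace (Fin n))) : Prop :=
  ∀ z ∈ f.toFun ⁻¹' {η} ∩ B, ¬ IsMixedCritical f.toFun z

/-- The part of the fibre `f⁻¹(η)` in `B` meets the sphere `S_r` transversely: at each common
point the two real tangent spaces span `ℂⁿ`. -/
def FibreTransverseToSphere (f : MixedPoly n) (η : ℂ) (B : Set (CSpace (Fin n))) (r : ℝ) :
    Prop :=
  ∀ z ∈ (f.toFun ⁻¹' {η} ∩ B) ∩ Metric.sphere 0 r,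
    fibreTangent f.toFun z ⊔ sphereTangent z = ⊤

end MixedPoly

end

/-! Both conclusions exclude a single phenomenon, `IsTangency`: for some b with |b| = 1 and some s ≥
0, Re(b̄ f_t) has the same differential as (s/2)‖z‖², with s = 0 at a critical point. If the claim
failed, there would be tangencies in a fixed ball with t → 0 and 0 ≠ f_t(z) → 0. An ultrafilter
along them makes z and b converge, by compactness, and plays the role of an arc given by curve
selection.

The core is `exists_dominant_weight`: along the ultrafilter the dominant monomials are those of
least weight for an integral weight w, with w_i = 0 exactly where lim z_i ≠ 0; divided by a common
scale M they converge to their values at a point a of the torus. In the direction c z_i e_i a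
derivative multiplies each monomial by a constant, so the tangency equations also pass to the limit.
They become equations at a for the face function of f_0, with right-hand sides γ_i = lim s|z_i|²/M
(`exists_limit_tangency`).

Let z0 = lim z. If z0 = 0, all weights are positive and s = 0, so γ = 0 contradicts strong
non-degeneracy. If z0 ≠ 0 and some monomial of f_0 is non-zero at z0, then z0 is a tangency on the
zero fibre of f_0; near the origin Euler's identity excludes this
(`eventually_no_tangency_of_toFun_eq_zero`). Otherwise f_0 vanishes on the coordinate subspace of
z0, the face is essential, and γ_i = 0 for i outside I_w contradicts local tameness. The last two
cases determine R', which depends on f_0 only. -/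

noncomputable section

namespace MixedPoly

variable {n : ℕ}

/-! ### Monomials and differentials in logarithmic coordinates -/

/-- The monomial function `z ↦ z^ν z̄^μ`. -/
def mon (m : (Fin n ⊕ Fin n) →₀ ℕ) (z : CSpace (Fin n)) : ℂ :=
  ∏ i, (z i ^ m (Sum.inl i) * starRingEnd ℂ (z i) ^ m (Sum.inr i))

/-- The sum of the terms of `f`, each multiplied by a factor depending on its exponent. -/
def wsum (f : MixedPoly n) (κ : ((Fin n ⊕ Fin n) →₀ ℕ) → ℂ) (z : CSpace (Fin n)) : ℂ :=
  ∑ m ∈ f.support, f.coeff m * κ m * mon m z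

/-- The factor by which the derivative in the direction `c z_i e_i` multiplies a monomial. -/
def logWeight (i : Fin n) (c : ℂ) (m : (Fin n ⊕ Fin n) →₀ ℕ) : ℂ :=
  m (Sum.inl i) * c + m (Sum.inr i) * starRingEnd ℂ c

lemma mon_eq_prod (m : (Fin n ⊕ Fin n) →₀ ℕ) (z : CSpace (Fin n)) :
    mon m z = ∏ j, (Sum.elim (fun i => z i) (fun i => starRingEnd ℂ (z i)) j) ^ m j := by
  rw [Fintype.prod_sum_type, mon, Finset.prod_mul_distrib]
  rfl

lemma eval_eq_sum_mon (f : MixedPoly n) (z : CSpace (Fin n)) :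
    f.toFun z = ∑ m ∈ f.support, f.coeff m * mon m z := by
  simp only [toFun, MvPolynomial.eval_eq', mon_eq_prod]

lemma toFun_eq_wsum (f : MixedPoly n) (z : CSpace (Fin n)) :
    f.toFun z = wsum f (fun _ => 1) z := by
  simp [eval_eq_sum_mon, wsum]

/-- The Euler operator X_j ∂_j is diagonal on monomials, with eigenvalue the exponent of X_j. This
is why derivatives along c z_i e_i are again weighted sums of the same terms. -/
lemma eval_pderiv_mul (f : MixedPoly n) (j : Fin n ⊕ Fin n) (z : CSpace (Fin n)) :
    MvPolynomial.eval (Sum.elim (fun i => z i) (fun i => starRingEnd ℂ (z i)))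
      (MvPolynomial.pderiv j f) * Sum.elim (fun i => z i) (fun i => starRingEnd ℂ (z i)) j
      = wsum f (fun m => m j) z := by
  have key : MvPolynomial.pderiv j f * MvPolynomial.X j
      = ∑ m ∈ f.support, MvPolynomial.monomial m (f.coeff m * m j) := by
    conv_lhs => rw [f.as_sum]
    rw [map_sum, Finset.sum_mul]
    refine Finset.sum_congr rfl fun m _ => ?_
    rw [mul_comm, MvPolynomial.X_mul_pderiv_monomial, nsmul_eq_mul, ← map_natCast MvPolynomial.C,
      MvPolynomial.C_mul_monomial, mul_comm]
  have := congrArg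
    (MvPolynomial.eval (Sum.elim (fun i => z i) (fun i => starRingEnd ℂ (z i)))) key
  rw [map_mul, MvPolynomial.eval_X, map_sum] at this
  rw [this, wsum]
  refine Finset.sum_congr rfl fun m _ => ?_
  rw [MvPolynomial.eval_monomial, mon_eq_prod, Finsupp.prod_fintype]
  simp

/-- Chain rule with arbitrary real-differentiable functions substituted for the variables, so that z
and z̄ can be treated as independent. -/
lemma hasFDerivAt_eval {E σ : Type*} [NormedAddCommGroup E] [NormedSpace ℝ E] [Fintype σ]
    (f : MvPolynomial σ ℂ) (Q : σ → E → ℂ) (Q' : σ → E →L[ℝ] ℂ) (x : E)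
    (h : ∀ j, HasFDerivAt (Q j) (Q' j) x) :
    HasFDerivAt (fun y => MvPolynomial.eval (fun j => Q j y) f)
      (∑ j, MvPolynomial.eval (fun j => Q j x) (MvPolynomial.pderiv j f) • Q' j) x := by
  classical
  induction f using MvPolynomial.induction_on with
  | C a =>
    simp only [MvPolynomial.eval_C]
    refine (hasFDerivAt_const (𝕜 := ℝ) a x).congr_fderiv (ContinuousLinearMap.ext fun v => ?_)
    simp
  | add p q hp hq =>
    simp only [map_add]
    refine (hp.add hq).congr_fderiv (ContinuousLinearMap.ext fun v => ?_)
    simp [add_mul, Finset.sum_add_distrib]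
  | mul_X p j hp =>
    simp only [map_mul, MvPolynomial.eval_X]
    refine (hp.mul (h j)).congr_fderiv (ContinuousLinearMap.ext fun v => ?_)
    have h1 : ∑ k, MvPolynomial.eval (fun j => Q j x) p * ((Pi.single k 1 : σ → ℂ) j * Q' k v) =
        MvPolynomial.eval (fun j => Q j x) p * Q' j v := by
      rw [Finset.sum_eq_single j (fun k _ hk => by simp [Pi.single_eq_of_ne hk.symm]) (by simp)]
      simp
    have h2 : ∀ k, MvPolynomial.eval (fun j => Q j x) ((Pi.single k 1 : σ → MvPolynomial σ ℂ) j) =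
        (Pi.single k 1 : σ → ℂ) j := fun k => by
      rw [Pi.single_apply, Pi.single_apply]
      split_ifs <;> simp
    simp [Derivation.leibniz, MvPolynomial.pderiv_X, add_mul, Finset.sum_add_distrib, h1, h2,
      Finset.mul_sum, mul_assoc]

/-- The differential of `f` along a parametrization, in logarithmic coordinates. -/
lemma exists_hasFDerivAt_toFun_comp {E : Type*} [NormedAddCommGroup E] [NormedSpace ℝ E]
    (f : MixedPoly n) (P : E → CSpace (Fin n)) (P' : Fin n → E →L[ℝ] ℂ) (x : E)
    (h : ∀ i, HasFDerivAt (fun y => P y i) (P' i) x) :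
    ∃ φ' : E →L[ℝ] ℂ, HasFDerivAt (fun y => f.toFun (P y)) φ' x ∧
      ∀ v (c : Fin n → ℂ), (∀ i, P' i v = c i * P x i) →
        φ' v = ∑ i, wsum f (logWeight i (c i)) (P x) := by
  have hQ : ∀ j, HasFDerivAt
      (fun y => Sum.elim (fun i => P y i) (fun i => starRingEnd ℂ (P y i)) j)
      (Sum.elim P' (fun i => (Complex.conjCLE : ℂ →L[ℝ] ℂ).comp (P' i)) j) x := by
    rintro (i | i)
    · exact h i
    · exact (Complex.conjCLE : ℂ →L[ℝ] ℂ).hasFDerivAt.comp x (h i)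
  refine ⟨_, hasFDerivAt_eval f _ _ x hQ, fun v c hc => ?_⟩
  rw [_root_.sum_apply, Fintype.sum_sum_type, ← Finset.sum_add_distrib]
  refine Finset.sum_congr rfl fun i _ => ?_
  have h1 := eval_pderiv_mul f (Sum.inl i) (P x)
  have h2 := eval_pderiv_mul f (Sum.inr i) (P x)
  simp only [Sum.elim_inl, Sum.elim_inr] at h1 h2
  have h3 : wsum f (logWeight i (c i)) (P x) = c i * wsum f (fun m => m (Sum.inl i)) (P x) +
      starRingEnd ℂ (c i) * wsum f (fun m => m (Sum.inr i)) (P x) := by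
    simp only [wsum, Finset.mul_sum, ← Finset.sum_add_distrib, logWeight]
    exact Finset.sum_congr rfl fun m _ => by ring
  rw [h3, ← h1, ← h2]
  simp only [Sum.elim_inl, Sum.elim_inr, _root_.smul_apply,
    ContinuousLinearMap.comp_apply, hc, smul_eq_mul, ContinuousLinearEquiv.coe_coe,
    Complex.conjCLE_apply, map_mul]
  ring

/-! ### Lagrange multipliers for critical points and non-transversality -/

section Critical

variable {ι : Type} [Fintype ι] {φ : CSpace ι → ℂ} {φ' : CSpace ι →L[ℝ] ℂ} {z : CSpace ι}

lemma fderiv_re_apply (h : HasFDerivAt φ φ' z) (v : CSpace ι) :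
    fderiv ℝ (fun x => (φ x).re) z v = (φ' v).re := by
  have : HasFDerivAt (fun x => (φ x).re) (Complex.reCLM.comp φ') z :=
    Complex.reCLM.hasFDerivAt.comp z h
  rw [this.fderiv]
  rfl

lemma fderiv_im_apply (h : HasFDerivAt φ φ' z) (v : CSpace ι) :
    fderiv ℝ (fun x => (φ x).im) z v = (φ' v).im := by
  have : HasFDerivAt (fun x => (φ x).im) (Complex.imCLM.comp φ') z :=
    Complex.imCLM.hasFDerivAt.comp z h
  rw [this.fderiv]
  rfl

lemma isMixedCritical_of_re_eq_zero (h : HasFDerivAt φ φ' z) {b : ℂ} (hb : b ≠ 0)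
    (hv : ∀ v, (starRingEnd ℂ b * φ' v).re = 0) : IsMixedCritical φ z := by
  rw [IsMixedCritical, LinearIndependent.pair_iff]
  intro H
  have := H b.re b.im (by
    ext v
    simpa [fderiv_re_apply h, fderiv_im_apply h] using hv v)
  exact hb (Complex.ext this.1 this.2)

/-- Turns a real combination of dg and dh into Re(b̄ dφ) with b on the unit circle, where limits of
b exist and stay non-zero. -/
lemma exists_unit_scale {α β : ℝ} (h : ¬ (α = 0 ∧ β = 0)) :
    ∃ (b : ℂ) (r : ℝ), ‖b‖ = 1 ∧ 0 < r ∧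
      ∀ u : ℂ, (starRingEnd ℂ b * u).re = r * (α * u.re + β * u.im) := by
  have h0 : (⟨α, β⟩ : ℂ) ≠ 0 := fun H => h ⟨congrArg Complex.re H, congrArg Complex.im H⟩
  have hn : 0 < ‖(⟨α, β⟩ : ℂ)‖ := norm_pos_iff.mpr h0
  refine ⟨((‖(⟨α, β⟩ : ℂ)‖⁻¹ : ℝ) : ℂ) * ⟨α, β⟩, ‖(⟨α, β⟩ : ℂ)‖⁻¹, ?_, inv_pos.mpr hn, fun u => ?_⟩
  · rw [norm_mul, Complex.norm_real, norm_inv, norm_norm, inv_mul_cancel₀ hn.ne']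
  · rw [map_mul, Complex.conj_ofReal, mul_assoc, Complex.re_ofReal_mul]
    simp

lemma exists_of_isMixedCritical (h : HasFDerivAt φ φ' z) (hc : IsMixedCritical φ z) :
    ∃ b : ℂ, ‖b‖ = 1 ∧ ∀ v, (starRingEnd ℂ b * φ' v).re = 0 := by
  rw [IsMixedCritical, LinearIndependent.pair_iff] at hc
  push Not at hc
  obtain ⟨α, β, h1, h2⟩ := hc
  obtain ⟨b, r, hb, -, hr⟩ := exists_unit_scale (α := α) (β := β) (fun H => h2 H.1 H.2)
  refine ⟨b, hb, fun v => ?_⟩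
  have := DFunLike.congr_fun h1 v
  simp only [_root_.add_apply, _root_.smul_apply, fderiv_re_apply h,
    fderiv_im_apply h, smul_eq_mul, _root_.zero_apply] at this
  rw [hr, this, mul_zero]

/-- The sphere's tangent space is the kernel of ℓ = Re⟨z, ·⟩. A fibre tangent vector outside this
hyperplane would make the sum everything, so ℓ vanishes on ker dg ∩ ker dh and is a combination of
dg and dh. The coefficients are not both zero since ℓ(z) = ‖z‖² ≠ 0. -/
lemma exists_of_not_transverse (h : HasFDerivAt φ φ' z) (hz : z ≠ 0)
    (ht : fibreTangent φ z ⊔ sphereTangent z ≠ ⊤) :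
    ∃ (b : ℂ) (s : ℝ), ‖b‖ = 1 ∧ 0 ≤ s ∧
      ∀ v, (starRingEnd ℂ b * φ' v).re = s * (inner ℂ z v).re := by
  let ℓ : CSpace ι →ₗ[ℝ] ℝ :=
    { toFun := fun v => (inner ℂ z v).re
      map_add' := fun a b => by rw [inner_add_right, Complex.add_re]
      map_smul' := fun c a => by
        rw [← Complex.coe_smul, inner_smul_right, Complex.re_ofReal_mul]; rfl }
  have hker : fibreTangent φ z ≤ LinearMap.ker ℓ := by
    intro v hv
    by_contra hv0
    replace hv0 : ℓ v ≠ 0 := hv0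
    refine ht (eq_top_iff.mpr fun u _ => ?_)
    have : u = (ℓ u / ℓ v) • v + (u - (ℓ u / ℓ v) • v) := by abel
    rw [this]
    refine Submodule.add_mem_sup (Submodule.smul_mem _ _ hv) ?_
    change ℓ (u - (ℓ u / ℓ v) • v) = 0
    rw [map_sub, map_smul, smul_eq_mul, div_mul_cancel₀ _ hv0, sub_self]
  have hspan := mem_span_of_iInf_ker_le_ker
    (L := ![(fderiv ℝ (fun x => (φ x).re) z).toLinearMap,
      (fderiv ℝ (fun x => (φ x).im) z).toLinearMap]) (K := ℓ) (by
    refine le_trans (fun v hv => ?_) hker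
    rw [Submodule.mem_iInf] at hv
    exact ⟨hv 0, hv 1⟩)
  rw [Matrix.range_cons, Matrix.range_cons, Matrix.range_empty, Set.union_empty,
    Set.singleton_union, Submodule.mem_span_pair] at hspan
  obtain ⟨α, β, hαβ⟩ := hspan
  have hv : ∀ v, α * (φ' v).re + β * (φ' v).im = (inner ℂ z v).re := by
    intro v
    change _ = ℓ v
    rw [← hαβ]
    simp [fderiv_re_apply h, fderiv_im_apply h]
  obtain ⟨b, r, hb, hr0, hr⟩ := exists_unit_scale (α := α) (β := β) (by
    rintro ⟨rfl, rfl⟩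
    have := hv z
    have h2 : (inner ℂ z z).re = ‖z‖ ^ 2 := (norm_sq_eq_re_inner (𝕜 := ℂ) z).symm
    rw [h2] at this
    simp only [zero_mul, add_zero] at this
    exact hz (norm_eq_zero.mp (pow_eq_zero_iff two_ne_zero |>.mp this.symm)))
  exact ⟨b, r, hb, hr0.le, fun v => by rw [hr, hv]⟩

end Critical

/-! ### Tangencies -/

/-- At `z` the function `Re (b̄ f)` has the same differential as `(s / 2) ‖z‖²` along the
directions `c z_i e_i`. -/
structure IsTangency (f : MixedPoly n) (b : ℂ) (s : ℝ) (z : CSpace (Fin n)) : Prop where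
  norm_eq : ‖b‖ = 1
  nonneg : 0 ≤ s
  eq : ∀ i c, (starRingEnd ℂ b * wsum f (logWeight i c) z).re = s * c.re * ‖z i‖ ^ 2

lemma wsum_logWeight_zero (f : MixedPoly n) (i : Fin n) (z : CSpace (Fin n)) :
    wsum f (logWeight i 0) z = 0 := by
  simp [wsum, logWeight]

lemma exists_hasFDerivAt_toFun (f : MixedPoly n) (z : CSpace (Fin n)) :
    ∃ φ' : CSpace (Fin n) →L[ℝ] ℂ, HasFDerivAt f.toFun φ' z ∧
      ∀ v (c : Fin n → ℂ), (∀ i, v i = c i * z i) →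
        φ' v = ∑ i, wsum f (logWeight i (c i)) z :=
  exists_hasFDerivAt_toFun_comp f id
    (fun i => (EuclideanSpace.proj i : CSpace (Fin n) →L[ℂ] ℂ).restrictScalars ℝ) z
    fun i => ((EuclideanSpace.proj i : CSpace (Fin n) →L[ℂ] ℂ).restrictScalars ℝ).hasFDerivAt

lemma isTangency_of_forall {f : MixedPoly n} {z : CSpace (Fin n)}
    {φ' : CSpace (Fin n) →L[ℝ] ℂ}
    (hφ' : ∀ v (c : Fin n → ℂ), (∀ i, v i = c i * z i) →
        φ' v = ∑ i, wsum f (logWeight i (c i)) z)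
    {b : ℂ} {s : ℝ} (hb : ‖b‖ = 1) (hs : 0 ≤ s)
    (hv : ∀ v, (starRingEnd ℂ b * φ' v).re = s * (inner ℂ z v).re) : IsTangency f b s z := by
  refine ⟨hb, hs, fun i c => ?_⟩
  have h1 := hφ' (EuclideanSpace.single i (c * z i)) (Pi.single i c) (fun j => by
    by_cases hj : j = i
    · subst hj; simp
    · simp [hj])
  rw [Finset.sum_eq_single i (fun j _ hj => by
    rw [Pi.single_eq_of_ne hj, wsum_logWeight_zero]) (by simp), Pi.single_eq_same] at h1
  rw [← h1, hv, EuclideanSpace.inner_single_right, mul_assoc, mul_assoc, Complex.mul_conj,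
    Complex.re_mul_ofReal, Complex.normSq_eq_norm_sq]

lemma exists_isTangency_of_isMixedCritical {f : MixedPoly n} {z : CSpace (Fin n)}
    (h : IsMixedCritical f.toFun z) : ∃ b, IsTangency f b 0 z := by
  obtain ⟨φ', h1, h2⟩ := exists_hasFDerivAt_toFun f z
  obtain ⟨b, hb, hv⟩ := exists_of_isMixedCritical h1 h
  exact ⟨b, isTangency_of_forall h2 hb le_rfl (by simpa using hv)⟩

lemma exists_isTangency_of_not_transverse {f : MixedPoly n} {z : CSpace (Fin n)} (hz : z ≠ 0)
    (h : fibreTangent f.toFun z ⊔ sphereTangent z ≠ ⊤) : ∃ b s, IsTangency f b s z := by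
  obtain ⟨φ', h1, h2⟩ := exists_hasFDerivAt_toFun f z
  obtain ⟨b, s, hb, hs, hv⟩ := exists_of_not_transverse h1 hz h
  exact ⟨b, s, isTangency_of_forall h2 hb hs hv⟩

/-- On the torus the directions c z_i e_i span the whole tangent space, so the logarithmic equations
detect critical points. -/
lemma isMixedCritical_of_wsum {f : MixedPoly n} {z : CSpace (Fin n)} (hz : ∀ i, z i ≠ 0) {b : ℂ}
    (hb : b ≠ 0) (h : ∀ i c, (starRingEnd ℂ b * wsum f (logWeight i c) z).re = 0) :
    IsMixedCritical f.toFun z := by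
  obtain ⟨φ', h1, h2⟩ := exists_hasFDerivAt_toFun f z
  refine isMixedCritical_of_re_eq_zero h1 hb fun v => ?_
  rw [h2 v (fun i => v i / z i) (fun i => (div_mul_cancel₀ _ (hz i)).symm), Finset.mul_sum,
    Complex.re_sum]
  exact Finset.sum_eq_zero fun i _ => h i _

lemma isCriticalOff_of_wsum {f : MixedPoly n} {I : Finset (Fin n)} {z : CSpace (Fin n)}
    (hz : ∀ i, z i ≠ 0) {b : ℂ} (hb : b ≠ 0)
    (h : ∀ i ∉ I, ∀ c, (starRingEnd ℂ b * wsum f (logWeight i c) z).re = 0) :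
    f.IsCriticalOff I z := by
  classical
  have hrep : replaceOff I z (WithLp.toLp 2 (fun i => z i.1)) = z := by
    ext i
    simp [replaceOff]
  obtain ⟨φ', h1, h2⟩ := exists_hasFDerivAt_toFun_comp f
    (fun v : CSpace {i : Fin n // i ∉ I} => replaceOff I z v)
    (fun i => if h : i ∈ I then 0 else
      (EuclideanSpace.proj (⟨i, h⟩ : {i : Fin n // i ∉ I}) :
        CSpace {i : Fin n // i ∉ I} →L[ℂ] ℂ).restrictScalars ℝ)
    (WithLp.toLp 2 (fun i => z i.1)) (fun i => by
      by_cases hi : i ∈ I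
      · simpa [replaceOff, hi] using hasFDerivAt_const (z i) _
      · simpa [replaceOff, hi] using ((EuclideanSpace.proj (⟨i, hi⟩ : {i : Fin n // i ∉ I}) :
          CSpace {i : Fin n // i ∉ I} →L[ℂ] ℂ).restrictScalars ℝ).hasFDerivAt)
  rw [hrep] at h2
  refine isMixedCritical_of_re_eq_zero h1 hb fun v => ?_
  rw [h2 v (fun i => if h : i ∈ I then 0 else v ⟨i, h⟩ / z i) (fun i => by
    by_cases hi : i ∈ I
    · simp [hi]
    · simp [hi, div_mul_cancel₀ _ (hz i)]), Finset.mul_sum, Complex.re_sum]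
  refine Finset.sum_eq_zero fun i _ => ?_
  by_cases hi : i ∈ I
  · simp [hi, wsum_logWeight_zero]
  · exact h i hi _

end MixedPoly

end

/-! ### Newton polygons and faces cut out by weights -/

noncomputable section

namespace MixedPoly

variable {n : ℕ}

/-- The weighted degree of a monomial. -/
def wdeg (w : Fin n → ℝ) (m : (Fin n ⊕ Fin n) →₀ ℕ) : ℝ := ∑ i, w i * expSum m i

open scoped Pointwise in
lemma newtonPolygon_eq (f : MixedPoly n) :
    f.newtonPolygon = convexHull ℝ (expSum '' {m | m ∈ f.support}) + {ξ : Fin n → ℝ | ∀ i, 0 ≤ ξ i} := by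
  have hconv : Convex ℝ {ξ : Fin n → ℝ | ∀ i, 0 ≤ ξ i} := by
    have : {ξ : Fin n → ℝ | ∀ i, 0 ≤ ξ i} = Set.Ici 0 := by ext; simp [Pi.le_def]
    rw [this]
    exact convex_Ici 0
  rw [← hconv.convexHull_eq, ← convexHull_add, newtonPolygon]
  congr 1
  ext ξ
  simp only [Set.mem_iUnion, Set.mem_add, Set.mem_image, Set.mem_ofPred_eq, exists_prop]
  constructor
  · rintro ⟨m, hm, h⟩
    exact ⟨_, ⟨m, hm, rfl⟩, ξ - expSum m, fun i => sub_nonneg.mpr (h i), by abel⟩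
  · rintro ⟨_, ⟨m, hm, rfl⟩, o, ho, rfl⟩
    exact ⟨m, hm, fun i => le_add_of_nonneg_right (ho i)⟩

lemma expSum_mem_newtonPolygon {f : MixedPoly n} {m : (Fin n ⊕ Fin n) →₀ ℕ} (hm : m ∈ f.support) :
    expSum m ∈ f.newtonPolygon :=
  subset_convexHull ℝ _ (Set.mem_biUnion hm fun _ => le_rfl)

lemma le_of_mem_convexHull {s : Set (Fin n → ℝ)} {w : Fin n → ℝ} {d : ℝ}
    (h : ∀ ξ ∈ s, d ≤ ∑ i, w i * ξ i) {ξ : Fin n → ℝ} (hξ : ξ ∈ convexHull ℝ s) :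
    d ≤ ∑ i, w i * ξ i := by
  have hc : Convex ℝ {ξ : Fin n → ℝ | d ≤ ∑ i, w i * ξ i} :=
    convex_halfSpace_ge (IsLinearMap.mk (fun x y => by simp [mul_add, Finset.sum_add_distrib])
      (fun c x => by simp only [Pi.smul_apply, smul_eq_mul, Finset.mul_sum]
                     exact Finset.sum_congr rfl fun i _ => by ring)) d
  exact convexHull_min h hc hξ

lemma le_of_mem_newtonPolygon {f : MixedPoly n} {w : Fin n → ℝ} (hw : ∀ i, 0 ≤ w i) {d : ℝ}
    (h : ∀ m ∈ f.support, d ≤ wdeg w m) {ξ : Fin n → ℝ} (hξ : ξ ∈ f.newtonPolygon) :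
    d ≤ ∑ i, w i * ξ i := by
  refine le_of_mem_convexHull (fun ξ hξ => ?_) hξ
  simp only [Set.mem_iUnion] at hξ
  obtain ⟨m, hm, hle⟩ := hξ
  exact (h m hm).trans (Finset.sum_le_sum fun i _ => mul_le_mul_of_nonneg_left (hle i) (hw i))

lemma exists_minimal_support {f : MixedPoly n} (hf : f.support.Nonempty) (w : Fin n → ℝ) :
    ∃ m ∈ f.support, ∀ m' ∈ f.support, wdeg w m ≤ wdeg w m' :=
  Finset.exists_min_image _ _ hf

/-- A positive weight defines a compact face. -/
lemma isCompactFace_of_pos {f : MixedPoly n} (hf : f.support.Nonempty) {w : Fin n → ℝ}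
    (hw : ∀ i, 0 < w i) :
    f.IsCompactFace {ξ | ξ ∈ f.newtonPolygon ∧
      ∀ ζ ∈ f.newtonPolygon, ∑ i, w i * ξ i ≤ ∑ i, w i * ζ i} := by
  obtain ⟨m, hm, hmin⟩ := exists_minimal_support hf w
  have hle : ∀ ζ ∈ f.newtonPolygon, wdeg w m ≤ ∑ i, w i * ζ i :=
    fun ζ => le_of_mem_newtonPolygon (fun i => (hw i).le) hmin
  refine ⟨⟨expSum m, expSum_mem_newtonPolygon hm, hle⟩, fun _ => ?_, ?_⟩
  -- `IsExposed` selects maximisers, hence the sign.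
  · refine ⟨-∑ i, w i • ContinuousLinearMap.proj (R := ℝ) (φ := fun _ : Fin n => ℝ) i, ?_⟩
    ext ξ
    simp
  -- All weights being positive, a minimiser has no orthant component, so the face is a slice of the
  -- compact convex hull.
  · have hK : IsCompact (convexHull ℝ (expSum '' {m | m ∈ f.support}) ∩
        {ξ : Fin n → ℝ | ∑ i, w i * ξ i ≤ wdeg w m}) :=
      ((f.support.finite_toSet.image expSum).isCompact_convexHull ℝ).inter_right
        (isClosed_le (by fun_prop) continuous_const)
    convert hK using 1
    ext ξ
    constructor
    · rintro ⟨h1, h2⟩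
      have h3 := h2 _ (expSum_mem_newtonPolygon hm)
      refine ⟨?_, h3⟩
      rw [newtonPolygon_eq] at h1
      obtain ⟨p, hp, o, ho, rfl⟩ := h1
      have hp' : wdeg w m ≤ ∑ i, w i * p i := by
        refine le_of_mem_convexHull ?_ hp
        rintro _ ⟨m', hm', rfl⟩
        exact hmin m' hm'
      have h4 : ∑ i, w i * o i = 0 := by
        refine le_antisymm ?_ (Finset.sum_nonneg fun i _ => mul_nonneg (hw i).le (ho i))
        have : ∑ i, w i * (p + o) i = ∑ i, w i * p i + ∑ i, w i * o i := by
          simp [mul_add, Finset.sum_add_distrib]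
        change _ ≤ wdeg w m at h3
        simp only [] at this h3
        linarith
      have h5 : o = 0 := by
        ext i
        have := (Finset.sum_eq_zero_iff_of_nonneg
          (fun i _ => mul_nonneg (hw i).le (ho i))).mp h4 i (Finset.mem_univ i)
        exact (mul_eq_zero.mp this).resolve_left (hw i).ne'
      simpa [h5] using hp
    · rintro ⟨h1, h2⟩
      refine ⟨?_, fun ζ hζ => le_trans h2 (hle ζ hζ)⟩
      rw [newtonPolygon_eq]
      exact ⟨ξ, h1, 0, fun _ => le_rfl, by simp⟩

/-- The Newton boundary determines the least value of a non-negative weight. -/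
lemma le_wdeg_of_newtonBoundary_subset {f g : MixedPoly n}
    (h : f.newtonBoundary ⊆ g.newtonBoundary) {w : Fin n → ℝ} (hw : ∀ i, 0 ≤ w i) {d : ℝ}
    (hg : ∀ m ∈ g.support, d ≤ wdeg w m) {m : (Fin n ⊕ Fin n) →₀ ℕ} (hm : m ∈ f.support) :
    d ≤ wdeg w m := by
  -- A weight with zeros may have a non-compact face, invisible to the Newton boundary. Adding ε to
  -- every weight makes the face compact; then ε → 0.
  have key : ∀ ε : ℝ, 0 < ε → d ≤ wdeg w m + ε * ∑ i, expSum m i := by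
    intro ε hε
    have hpos : ∀ i, 0 < w i + ε := fun i => add_pos_of_nonneg_of_pos (hw i) hε
    have hface := isCompactFace_of_pos ⟨m, hm⟩ hpos
    obtain ⟨ξ, hξ⟩ := hface.1
    obtain ⟨Δ, hΔ, hξΔ⟩ := h (Set.mem_sUnion_of_mem hξ hface)
    have h1 : d ≤ ∑ i, (w i + ε) * ξ i := by
      refine le_of_mem_newtonPolygon (fun i => (hpos i).le) (fun m' hm' => ?_)
        (hΔ.2.1.subset hξΔ)
      refine (hg m' hm').trans (Finset.sum_le_sum fun i _ => ?_)
      exact mul_le_mul_of_nonneg_right (by linarith) (by unfold expSum; positivity)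
    refine (h1.trans (hξ.2 _ (expSum_mem_newtonPolygon hm))).trans (le_of_eq ?_)
    simp [wdeg, add_mul, Finset.sum_add_distrib, Finset.mul_sum]
  have hlim : Tendsto (fun ε : ℝ => wdeg w m + ε * ∑ i, expSum m i) (𝓝[>] 0) (𝓝 (wdeg w m)) := by
    have : Tendsto (fun ε : ℝ => wdeg w m + ε * ∑ i, expSum m i) (𝓝 0)
        (𝓝 (wdeg w m + 0 * ∑ i, expSum m i)) := by
      apply Continuous.tendsto
      fun_prop
    simpa using this.mono_left nhdsWithin_le_nhds
  exact ge_of_tendsto hlim (eventually_nhdsWithin_of_forall key)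

lemma expSum_mem_weightFace_iff {f : MixedPoly n} {w : Fin n → ℕ}
    {m : (Fin n ⊕ Fin n) →₀ ℕ} (hm : m ∈ f.support) :
    expSum m ∈ f.weightFace w ↔
      ∀ m' ∈ f.support, wdeg (fun i => (w i : ℝ)) m ≤ wdeg (fun i => (w i : ℝ)) m' :=
  ⟨fun h _ hm' => h.2 _ (expSum_mem_newtonPolygon hm'), fun h =>
    ⟨expSum_mem_newtonPolygon hm, fun _ => le_of_mem_newtonPolygon (fun _ => Nat.cast_nonneg _) h⟩⟩

lemma weightFace_nonempty {f : MixedPoly n} (hf : f.support.Nonempty) (w : Fin n → ℕ) :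
    (f.weightFace w).Nonempty := by
  obtain ⟨m, hm, h⟩ := exists_minimal_support hf (fun i => (w i : ℝ))
  exact ⟨_, (expSum_mem_weightFace_iff hm).mpr h⟩

lemma newtonPolygon_add_single {f : MixedPoly n} {ξ : Fin n → ℝ} (hξ : ξ ∈ f.newtonPolygon)
    (i : Fin n) {s : ℝ} (hs : 0 ≤ s) : ξ + s • Pi.single i (1 : ℝ) ∈ f.newtonPolygon := by
  rw [newtonPolygon_eq] at hξ ⊢
  obtain ⟨p, hp, o, ho, rfl⟩ := hξ
  refine ⟨p, hp, o + s • Pi.single i (1 : ℝ), fun j => add_nonneg (ho j) ?_, (add_assoc _ _ _).symm⟩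
  by_cases hj : j = i
  · subst hj; simpa
  · simp [hj]

lemma weightFace_add_single {f : MixedPoly n} {w : Fin n → ℕ} {i : Fin n} (hi : w i = 0)
    {ξ : Fin n → ℝ} (hξ : ξ ∈ f.weightFace w) {s : ℝ} (hs : 0 ≤ s) :
    ξ + s • Pi.single i (1 : ℝ) ∈ f.weightFace w := by
  refine ⟨newtonPolygon_add_single hξ.1 i hs, fun ζ hζ => le_trans (le_of_eq ?_) (hξ.2 ζ hζ)⟩
  refine Finset.sum_congr rfl fun j _ => ?_
  by_cases hj : j = i
  · subst hj; simp [hi]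
  · simp [hj]

lemma not_isCompact_weightFace {f : MixedPoly n} (hf : f.support.Nonempty) {w : Fin n → ℕ}
    {i : Fin n} (hi : w i = 0) : ¬ IsCompact (f.weightFace w) := by
  intro hc
  obtain ⟨ξ, hξ⟩ := weightFace_nonempty hf w
  obtain ⟨C, hC⟩ := (hc.image (continuous_apply i)).bddAbove
  have h0 : ξ i ≤ C := hC ⟨ξ, hξ, rfl⟩
  have h1 : (ξ + (C - ξ i + 1) • (Pi.single i (1 : ℝ) : Fin n → ℝ)) i ≤ C :=
    hC ⟨_, weightFace_add_single hi hξ (by linarith), rfl⟩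
  simp only [Pi.add_apply, Pi.smul_apply, Pi.single_eq_same, smul_eq_mul] at h1
  linarith

/-- `hv` makes every monomial of f vanish where the coordinates of positive weight do; a zero weight
gives the face an unbounded direction. -/
lemma isEssentialFace_weightFace {f : MixedPoly n} (hf : f.support.Nonempty) {w : Fin n → ℕ}
    (h0 : ∃ i, w i = 0) (hv : ∀ m ∈ f.support, ∃ i, w i ≠ 0 ∧ (m (.inl i) ≠ 0 ∨ m (.inr i) ≠ 0)) :
    f.IsEssentialFace (f.weightFace w) w := by
  obtain ⟨i, hi⟩ := h0
  refine ⟨?_, not_isCompact_weightFace hf hi, rfl, fun z hz => ?_, fun i hi α hα s hs => ?_⟩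
  · obtain ⟨m, hm⟩ := hf
    obtain ⟨j, hj, -⟩ := hv m hm
    exact fun h => hj (by simp [h])
  · rw [toFun, MvPolynomial.eval_eq']
    refine Finset.sum_eq_zero fun m hm => ?_
    obtain ⟨j, hj, h⟩ := hv m hm
    have hzj : z j = 0 := hz j (by simp [zeroSet, hj])
    rcases h with h | h
    · rw [Finset.prod_eq_zero (Finset.mem_univ (Sum.inl j)) (by simp [hzj, h]), mul_zero]
    · rw [Finset.prod_eq_zero (Finset.mem_univ (Sum.inr j)) (by simp [hzj, h]), mul_zero]
  · exact weightFace_add_single (by simpa [zeroSet] using hi) hα hs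

end MixedPoly

end

/-! ### Integral directions and limits along ultrafilters -/

noncomputable section

/-- A generalised inverse g: extend to W a section of V → range f. Then 1 - g ∘ f projects onto ker
f. -/
lemma LinearMap.exists_comp_comp_eq {K V W : Type*} [Field K] [AddCommGroup V] [Module K V]
    [AddCommGroup W] [Module K W] (f : V →ₗ[K] W) : ∃ g : W →ₗ[K] V, f ∘ₗ g ∘ₗ f = f := by
  obtain ⟨s, hs⟩ := f.rangeRestrict.exists_rightInverse_of_surjective f.range_rangeRestrict
  obtain ⟨g, hg⟩ := s.exists_extend
  refine ⟨g, LinearMap.ext fun v => ?_⟩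
  have h1 : g (f v) = s (f.rangeRestrict v) := LinearMap.congr_fun hg (f.rangeRestrict v)
  have h2 := congrArg Subtype.val (LinearMap.congr_fun hs (f.rangeRestrict v))
  simpa [h1] using h2

lemma Matrix.exists_mul_mul_eq {K m n : Type*} [Field K] [Fintype m] [Fintype n]
    [DecidableEq m] [DecidableEq n] (B : Matrix m n K) : ∃ T : Matrix n m K, B * T * B = B := by
  obtain ⟨g, hg⟩ := (Matrix.toLin' B).exists_comp_comp_eq
  refine ⟨LinearMap.toMatrix' g, Matrix.toLin'.injective ?_⟩
  rw [Matrix.toLin'_mul, Matrix.toLin'_mul, Matrix.toLin'_toMatrix']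
  exact hg

lemma exists_int_multiple {n : ℕ} (q : Fin n → ℚ) :
    ∃ (D : ℕ) (w : Fin n → ℤ), 0 < D ∧ ∀ i, (w i : ℚ) = D * q i := by
  refine ⟨∏ i, (q i).den, fun i => (q i).num * ∏ j ∈ Finset.univ.erase i, ((q j).den : ℤ),
    Finset.prod_pos fun i _ => (q i).den_pos, fun i => ?_⟩
  rw [← Finset.mul_prod_erase _ _ (Finset.mem_univ i)]
  push_cast
  rw [← Rat.mul_den_eq_num]
  ring

/-- A family of points of `ℝⁿ` on which finitely many integral functionals are bounded or tend to
`+∞` is at bounded distance from the common kernel of the bounded ones, and this kernel contains an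
integral point on which the unbounded ones are positive. -/
lemma exists_integral_direction {X : Type*} {n : ℕ} (F : Filter X) [F.NeBot] (x : X → Fin n → ℝ)
    (Eb Eu : Finset (Fin n → ℤ))
    (hb : ∀ ℓ ∈ Eb, ∃ C : ℝ, ∀ᶠ p in F, |∑ i, (ℓ i : ℝ) * x p i| ≤ C)
    (hu : ∀ ℓ ∈ Eu, Tendsto (fun p => ∑ i, (ℓ i : ℝ) * x p i) F atTop) :
    ∃ (y : X → Fin n → ℝ) (w : Fin n → ℤ),
      (∃ C : ℝ, ∀ᶠ p in F, ∀ i, |x p i - y p i| ≤ C) ∧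
      (∀ ℓ ∈ Eb, ∑ i, ℓ i * w i = 0 ∧ ∀ p, ∑ i, (ℓ i : ℝ) * y p i = 0) ∧
      (∀ ℓ ∈ Eu, 0 < ∑ i, ℓ i * w i) := by
  classical
  let B : Matrix Eb (Fin n) ℚ := fun e i => (e.1 i : ℚ)
  obtain ⟨T, hT⟩ := B.exists_mul_mul_eq
  let r : ℚ →+* ℝ := Rat.castHom ℝ
  let BR : Matrix Eb (Fin n) ℝ := B.map r
  let TR : Matrix (Fin n) Eb ℝ := T.map r
  have hTR : BR * TR * BR = BR := by
    simp only [BR, TR, ← Matrix.map_mul, hT]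
  -- The projection 1 - TB onto the common kernel of the bounded functionals. Being defined over ℚ,
  -- it sends rational points to rational points.
  let P : (Fin n → ℝ) → (Fin n → ℝ) := fun v => v - TR.mulVec (BR.mulVec v)
  have hBP : ∀ v, BR.mulVec (P v) = 0 := by
    intro v
    simp only [P, Matrix.mulVec_sub, Matrix.mulVec_mulVec, ← Matrix.mul_assoc, hTR, sub_self]
  have hBe : ∀ (e : Eb) v, BR.mulVec v e = ∑ i, (e.1 i : ℝ) * v i := by
    intro e v
    have h : ∀ i, BR e i = (e.1 i : ℝ) := fun i => by
      change ((e.1 i : ℚ) : ℝ) = _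
      push_cast
      rfl
    simp only [Matrix.mulVec, dotProduct, h]
  have hbd : ∃ C : ℝ, ∀ᶠ p in F, ∀ i, |x p i - P (x p) i| ≤ C := by
    choose! C hC using hb
    have hall : ∀ᶠ p in F, ∀ e : Eb, |∑ i, (e.1 i : ℝ) * x p i| ≤ C e.1 :=
      eventually_all.mpr fun e => hC e.1 e.2
    refine ⟨∑ i, ∑ e, |TR i e| * C e.1, hall.mono fun p hp i => ?_⟩
    have hterm : ∀ j e, 0 ≤ |TR j e| * C e.1 := fun j e =>
      mul_nonneg (abs_nonneg _) ((abs_nonneg _).trans (hp e))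
    calc |x p i - P (x p) i| = |∑ e, TR i e * BR.mulVec (x p) e| := by
          simp only [P, Pi.sub_apply, sub_sub_cancel]; rfl
      _ ≤ ∑ e, |TR i e| * C e.1 := by
          refine (Finset.abs_sum_le_sum_abs _ _).trans (Finset.sum_le_sum fun e _ => ?_)
          rw [abs_mul, hBe]
          exact mul_le_mul_of_nonneg_left (hp e) (abs_nonneg _)
      _ ≤ _ := Finset.single_le_sum (f := fun j => ∑ e, |TR j e| * C e.1)
          (fun j _ => Finset.sum_nonneg fun e _ => hterm j e) (Finset.mem_univ i)
  have hpos : ∀ ℓ ∈ Eu, ∀ᶠ p in F, 0 < ∑ i, (ℓ i : ℝ) * P (x p) i := by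
    intro ℓ hℓ
    obtain ⟨C, hC⟩ := hbd
    filter_upwards [hC, (hu ℓ hℓ).eventually_gt_atTop (∑ i, |(ℓ i : ℝ)| * C)] with p hp hgt
    have h1 : ∑ i, (ℓ i : ℝ) * (x p i - P (x p) i) ≤ ∑ i, |(ℓ i : ℝ)| * C :=
      Finset.sum_le_sum fun i _ => (le_abs_self _).trans (by
        rw [abs_mul]; exact mul_le_mul_of_nonneg_left (hp i) (abs_nonneg _))
    simp only [mul_sub, Finset.sum_sub_distrib] at h1
    linarith
  obtain ⟨p0, hp0⟩ : ∃ p, ∀ ℓ ∈ Eu, 0 < ∑ i, (ℓ i : ℝ) * P (x p) i :=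
    (((Finset.eventually_all Eu).mpr hpos)).exists
  let U : Set (Fin n → ℝ) := {v | ∀ ℓ ∈ Eu, 0 < ∑ i, (ℓ i : ℝ) * P v i}
  have hPc : Continuous P := by
    refine continuous_id.sub ?_
    exact Continuous.matrix_mulVec continuous_const (Continuous.matrix_mulVec continuous_const continuous_id)
  have hU : IsOpen U := by
    have : U = ⋂ ℓ ∈ Eu, {v | 0 < ∑ i, (ℓ i : ℝ) * P v i} := by
      ext v; simp [U]
    rw [this]
    exact isOpen_biInter_finset fun ℓ _ => isOpen_lt continuous_const (by fun_prop)
  -- The unbounded functionals stay positive on P(x p0), so the open set U is non-empty and contains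
  -- a rational point q; clearing denominators in P(q) gives w.
  obtain ⟨q, hq⟩ := (DenseRange.piMap (fun _ : Fin n => Rat.denseRange_cast (𝕜 := ℝ))).exists_mem_open
    hU ⟨x p0, hp0⟩
  let q' : Fin n → ℚ := q - T.mulVec (B.mulVec q)
  have hq' : ∀ i, (q' i : ℝ) = P (Pi.map (fun _ => Rat.cast) q) i := by
    intro i
    simp only [q', P, Pi.sub_apply, Matrix.mulVec, dotProduct, TR, BR, Matrix.map_apply,
      Pi.map_apply]
    push_cast
    rfl
  obtain ⟨D, w, hD, hw⟩ := exists_int_multiple q'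
  have hwR : ∀ ℓ : Fin n → ℤ, ((∑ i, ℓ i * w i : ℤ) : ℝ) =
      D * ∑ i, (ℓ i : ℝ) * P (Pi.map (fun _ => Rat.cast) q) i := by
    intro ℓ
    push_cast
    rw [Finset.mul_sum]
    refine Finset.sum_congr rfl fun i _ => ?_
    have : (w i : ℝ) = D * q' i := by exact_mod_cast congrArg (Rat.cast : ℚ → ℝ) (hw i)
    rw [this, ← hq']
    ring
  refine ⟨fun p => P (x p), w, hbd, fun ℓ hℓ => ⟨?_, fun p => ?_⟩, fun ℓ hℓ => ?_⟩
  · have h1 := hwR ℓ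
    rw [← hBe ⟨ℓ, hℓ⟩, hBP, Pi.zero_apply, mul_zero] at h1
    exact_mod_cast h1
  · rw [← hBe ⟨ℓ, hℓ⟩, hBP, Pi.zero_apply]
  · have h1 := hwR ℓ
    have h2 : (0 : ℝ) < ((∑ i, ℓ i * w i : ℤ) : ℝ) := by
      rw [h1]; exact mul_pos (by exact_mod_cast hD) (hq ℓ hℓ)
    exact_mod_cast h2

/-- An ultrafilter decides each of the events g ≤ C; if none holds eventually, g exceeds every C. -/
lemma Ultrafilter.bounded_or_tendsto_atTop {X : Type*} (𝓤 : Ultrafilter X) (g : X → ℝ) {c : ℝ}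
    (hg : ∀ᶠ p in (𝓤 : Filter X), c ≤ g p) :
    (∃ C, ∀ᶠ p in (𝓤 : Filter X), |g p| ≤ C) ∨ Tendsto g 𝓤 atTop := by
  by_cases h : ∃ C, ∀ᶠ p in (𝓤 : Filter X), g p ≤ C
  · obtain ⟨C, hC⟩ := h
    refine Or.inl ⟨max C (-c), ?_⟩
    filter_upwards [hg, hC] with p h1 h2
    exact abs_le.mpr ⟨by linarith [le_max_right C (-c)], h2.trans (le_max_left _ _)⟩
  · refine Or.inr (tendsto_atTop.mpr fun C => ?_)
    have : ∀ᶠ p in (𝓤 : Filter X), ¬ g p ≤ C := by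
      rw [Ultrafilter.eventually_not]
      exact fun H => h ⟨C, H⟩
    exact this.mono fun p hp => (not_le.mp hp).le

lemma Ultrafilter.exists_tendsto_of_eventually_mem {X Y : Type*} [TopologicalSpace Y]
    (𝓤 : Ultrafilter X) (g : X → Y) {K : Set Y} (hK : IsCompact K)
    (hg : ∀ᶠ p in (𝓤 : Filter X), g p ∈ K) : ∃ y ∈ K, Tendsto g 𝓤 (𝓝 y) :=
  hK.ultrafilter_le_nhds (𝓤.map g) (le_principal_iff.mpr hg)

end

/-! ### Dominant monomials along an ultrafilter -/

noncomputable section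

namespace MixedPoly

variable {n : ℕ}

lemma mon_mul_exp (m : (Fin n ⊕ Fin n) →₀ ℕ) (z : CSpace (Fin n)) (y : Fin n → ℝ) :
    mon m (WithLp.toLp 2 fun i => z i * (Real.exp (y i) : ℂ)) =
      mon m z * (Real.exp (∑ i, expSum m i * y i) : ℂ) := by
  rw [Real.exp_sum, Complex.ofReal_prod, mon, mon, ← Finset.prod_mul_distrib]
  refine Finset.prod_congr rfl fun i _ => ?_
  have h : Real.exp (expSum m i * y i) =
      Real.exp (y i) ^ m (Sum.inl i) * Real.exp (y i) ^ m (Sum.inr i) := by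
    rw [← Real.exp_nat_mul, ← Real.exp_nat_mul, ← Real.exp_add, expSum, add_mul]
  simp only [map_mul, Complex.conj_ofReal, mul_pow, h]
  push_cast
  ring

lemma mon_ne_zero_iff {m : (Fin n ⊕ Fin n) →₀ ℕ} {z : CSpace (Fin n)} :
    mon m z ≠ 0 ↔ ∀ i, z i = 0 → m (.inl i) = 0 ∧ m (.inr i) = 0 := by
  rw [mon, Finset.prod_ne_zero_iff]
  refine ⟨fun h i hi => ?_, fun h i _ => ?_⟩
  · have := h i (Finset.mem_univ i)
    rw [hi, map_zero, mul_ne_zero_iff] at this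
    exact ⟨by_contra fun H => this.1 (zero_pow H), by_contra fun H => this.2 (zero_pow H)⟩
  · by_cases hi : z i = 0
    · simp [h i hi]
    · exact mul_ne_zero (pow_ne_zero _ hi) (pow_ne_zero _ (by simpa using hi))

/-- Passing to the limit along an ultrafilter, the monomials which dominate a finite set of
monomials are those of least weight for suitable integral weights. -/
lemma exists_dominant_weight {X : Type*} (𝓤 : Ultrafilter X) (z : X → CSpace (Fin n))
    (z0 : CSpace (Fin n)) (hz : Tendsto z 𝓤 (𝓝 z0)) (S : Finset ((Fin n ⊕ Fin n) →₀ ℕ))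
    (hS : ∀ᶠ p in (𝓤 : Filter X), ∃ m ∈ S, mon m (z p) ≠ 0) :
    ∃ (w : Fin n → ℕ) (a : CSpace (Fin n)) (M : X → ℝ), (∀ p, 0 < M p) ∧ (∀ i, a i ≠ 0) ∧
      (∀ i, z0 i ≠ 0 → w i = 0 ∧ a i = z0 i) ∧ (∀ i, z0 i = 0 → 0 < w i) ∧
      ∀ m ∈ S,
        ((∀ m' ∈ S, wdeg (fun i => (w i : ℝ)) m ≤ wdeg (fun i => (w i : ℝ)) m') →
          Tendsto (fun p => mon m (z p) / (M p : ℂ)) 𝓤 (𝓝 (mon m a))) ∧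
        (¬ (∀ m' ∈ S, wdeg (fun i => (w i : ℝ)) m ≤ wdeg (fun i => (w i : ℝ)) m') →
          Tendsto (fun p => mon m (z p) / (M p : ℂ)) 𝓤 (𝓝 0)) := by
  classical
  have hzi : ∀ i, Tendsto (fun p => z p i) 𝓤 (𝓝 (z0 i)) := fun i =>
    ((EuclideanSpace.proj i : CSpace (Fin n) →L[ℂ] ℂ).continuous.tendsto z0).comp hz
  -- the coordinates which do not vanish along the ultrafilter, and the monomials in them
  let I : Finset (Fin n) := Finset.univ.filter fun i => ∀ᶠ p in (𝓤 : Filter X), z p i ≠ 0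
  have hI : ∀ i ∈ I, ∀ᶠ p in (𝓤 : Filter X), z p i ≠ 0 := fun i hi => (Finset.mem_filter.mp hi).2
  have hI' : ∀ i ∉ I, ∀ᶠ p in (𝓤 : Filter X), z p i = 0 := fun i hi => by
    have : ¬ ∀ᶠ p in (𝓤 : Filter X), z p i ≠ 0 := fun H => hi (by simpa [I] using H)
    rw [← Ultrafilter.eventually_not] at this
    simpa using this
  have hz0I : ∀ i, z0 i ≠ 0 → i ∈ I := fun i hi => by
    simpa [I] using (hzi i).eventually_ne hi
  let S' := S.filter fun m => ∀ i ∉ I, m (.inl i) = 0 ∧ m (.inr i) = 0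
  have hS'S : ∀ m ∈ S', m ∈ S := fun m hm => (Finset.mem_filter.mp hm).1
  have hS'0 : ∀ m ∈ S', ∀ i ∉ I, m (.inl i) = 0 ∧ m (.inr i) = 0 := fun m hm =>
    (Finset.mem_filter.mp hm).2
  have hS'ne : S'.Nonempty := by
    obtain ⟨p, ⟨m, hm, hmz⟩, hp⟩ := (hS.and
      (eventually_all.mpr fun i : {i // i ∉ I} => hI' i.1 i.2)).exists
    exact ⟨m, Finset.mem_filter.mpr ⟨hm, fun i hi => mon_ne_zero_iff.mp hmz i (hp ⟨i, hi⟩)⟩⟩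
  let e : ((Fin n ⊕ Fin n) →₀ ℕ) → Fin n → ℤ := fun m i => m (.inl i) + m (.inr i)
  have heR : ∀ m i, ((e m i : ℤ) : ℝ) = expSum m i := fun m i => by simp [e, expSum]
  have heI : ∀ m ∈ S', ∀ i ∉ I, expSum m i = 0 := fun m hm i hi => by
    simp [expSum, hS'0 m hm i hi]
  let x : X → Fin n → ℝ := fun p i => -Real.log ‖z p i‖
  -- In the coordinates x = -log|z|, a monomial of largest modulus has least ⟨m, x⟩. Among finitely
  -- many candidates the ultrafilter selects one, m0.
  obtain ⟨m0, hm0, hmin⟩ : ∃ m0 ∈ S', ∀ᶠ p in (𝓤 : Filter X),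
      ∀ m ∈ S', ∑ i, expSum m0 i * x p i ≤ ∑ i, expSum m i * x p i :=
    (Ultrafilter.eventually_exists_mem_iff (Finset.finite_toSet S')).mp
      (Eventually.of_forall fun p => Finset.exists_min_image S' _ hS'ne)
  have hdiff : ∀ m (v : Fin n → ℝ), ∑ i, (((e m - e m0) i : ℤ) : ℝ) * v i =
      ∑ i, expSum m i * v i - ∑ i, expSum m0 i * v i := fun m v => by
    simp [sub_mul, heR, Finset.sum_sub_distrib]
  have hsingle : ∀ i (v : Fin n → ℝ), ∑ j, (((Pi.single i 1 : Fin n → ℤ) j : ℤ) : ℝ) * v j = v i := by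
    intro i v
    rw [Finset.sum_eq_single i (fun j _ hj => by simp [hj]) (by simp)]
    simp
  let Bd : (Fin n → ℤ) → Prop := fun ℓ =>
    ∃ C : ℝ, ∀ᶠ p in (𝓤 : Filter X), |∑ i, (ℓ i : ℝ) * x p i| ≤ C
  -- The differences m - m0 compare monomials with m0; the coordinate functionals record which z_i
  -- tend to 0.
  let E : Finset (Fin n → ℤ) := S'.image (fun m => e m - e m0) ∪ I.image (fun i => Pi.single i 1)
  have hdich : ∀ ℓ ∈ E, Bd ℓ ∨ Tendsto (fun p => ∑ i, (ℓ i : ℝ) * x p i) 𝓤 atTop := by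
    intro ℓ hℓ
    rcases Finset.mem_union.mp hℓ with h | h
    · obtain ⟨m, hm, rfl⟩ := Finset.mem_image.mp h
      refine 𝓤.bounded_or_tendsto_atTop _ (c := 0) (hmin.mono fun p hp => ?_)
      rw [hdiff]
      exact sub_nonneg.mpr (hp m hm)
    · obtain ⟨i, hi, rfl⟩ := Finset.mem_image.mp h
      have hbd := ((hzi i).norm).eventually_le_const (lt_add_one _)
      refine 𝓤.bounded_or_tendsto_atTop _ (c := -Real.log (‖z0 i‖ + 1)) ?_
      filter_upwards [hbd, hI i hi] with p hp hp0
      rw [hsingle]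
      exact neg_le_neg (Real.log_le_log (norm_pos_iff.mpr hp0) hp)
  obtain ⟨y, w1, ⟨C, hC⟩, hyb, hyu⟩ := exists_integral_direction (𝓤 : Filter X) x
    (E.filter Bd) (E.filter fun ℓ => ¬ Bd ℓ) (fun ℓ hℓ => (Finset.mem_filter.mp hℓ).2)
    (fun ℓ hℓ => (hdich ℓ (Finset.mem_filter.mp hℓ).1).resolve_left (Finset.mem_filter.mp hℓ).2)
  have hEm : ∀ m ∈ S', e m - e m0 ∈ E := fun m hm =>
    Finset.mem_union_left _ (Finset.mem_image_of_mem _ hm)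
  have hEi : ∀ i ∈ I, (Pi.single i 1 : Fin n → ℤ) ∈ E := fun i hi =>
    Finset.mem_union_right _ (Finset.mem_image_of_mem (fun i => (Pi.single i 1 : Fin n → ℤ)) hi)
  have hsw : ∀ i, ∑ j, (Pi.single i 1 : Fin n → ℤ) j * w1 j = w1 i := fun i => by
    simp [Pi.single_apply]
  have hb0 : ∀ i, z0 i ≠ 0 → w1 i = 0 ∧ ∀ p, y p i = 0 := by
    intro i hi
    have hlim : Tendsto (fun p => x p i) 𝓤 (𝓝 (-Real.log ‖z0 i‖)) :=
      ((hzi i).norm.log (norm_ne_zero_iff.mpr hi)).neg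
    have hB : Bd (Pi.single i 1) := by
      refine ⟨|-Real.log ‖z0 i‖| + 1, ?_⟩
      simp only [hsingle]
      exact hlim.abs.eventually_le_const (lt_add_one _)
    have := hyb _ (Finset.mem_filter.mpr ⟨hEi i (hz0I i hi), hB⟩)
    rw [hsw] at this
    exact ⟨this.1, fun p => by rw [← hsingle i (y p)]; exact this.2 p⟩
  have hu0 : ∀ i ∈ I, z0 i = 0 → 0 < w1 i := by
    intro i hi hi0
    have hB : ¬ Bd (Pi.single i 1) := by
      rintro ⟨K, hK⟩
      simp only [hsingle] at hK
      have hlim : Tendsto (fun p => ‖z p i‖) 𝓤 (𝓝[≠] 0) := by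
        refine tendsto_nhdsWithin_iff.mpr ⟨?_, (hI i hi).mono fun p hp => norm_ne_zero_iff.mpr hp⟩
        simpa [hi0] using (hzi i).norm
      have htop : Tendsto (fun p => x p i) 𝓤 atTop :=
        tendsto_neg_atBot_atTop.comp (Real.tendsto_log_nhdsNE_zero.comp hlim)
      obtain ⟨p, hp1, hp2⟩ := (hK.and (htop.eventually_gt_atTop K)).exists
      exact absurd ((le_abs_self _).trans hp1) (not_le.mpr hp2)
    have := hyu _ (Finset.mem_filter.mpr ⟨hEi i hi, hB⟩)
    rwa [hsw] at this
  have hw1 : ∀ i ∈ I, 0 ≤ w1 i := fun i hi => by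
    by_cases h : z0 i = 0
    · exact (hu0 i hi h).le
    · exact (hb0 i h).1.ge
  -- the weights
  let D : ℤ := ∑ i, e m0 i * w1 i
  let w : Fin n → ℕ := fun i => if i ∈ I then (w1 i).toNat else D.toNat + 1
  have hwS' : ∀ m ∈ S', wdeg (fun i => (w i : ℝ)) m = ((∑ i, e m i * w1 i : ℤ) : ℝ) := by
    intro m hm
    rw [wdeg]
    push_cast
    refine Finset.sum_congr rfl fun i _ => ?_
    rw [heR]
    by_cases hi : i ∈ I
    · have : ((w1 i).toNat : ℝ) = (w1 i : ℝ) := by exact_mod_cast Int.toNat_of_nonneg (hw1 i hi)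
      simp only [w, if_pos hi, this, mul_comm]
    · rw [heI m hm i hi, mul_zero, zero_mul]
  -- Off I the weight is D.toNat + 1, larger than the weight D of m0, so any monomial containing a
  -- variable off I is not minimal.
  have hwD : ∀ m ∈ S, m ∉ S' → wdeg (fun i => (w i : ℝ)) m0 < wdeg (fun i => (w i : ℝ)) m := by
    intro m hm hm'
    obtain ⟨i, hi, hmi⟩ : ∃ i ∉ I, ¬ (m (.inl i) = 0 ∧ m (.inr i) = 0) := by
      by_contra! H
      exact hm' (Finset.mem_filter.mpr ⟨hm, H⟩)
    have h1 : (1 : ℝ) ≤ expSum m i := by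
      rw [expSum]
      norm_cast
      omega
    have h2 : (w i : ℝ) * expSum m i ≤ wdeg (fun i => (w i : ℝ)) m :=
      Finset.single_le_sum (f := fun i => (w i : ℝ) * expSum m i)
        (fun j _ => mul_nonneg (Nat.cast_nonneg _) (by unfold expSum; positivity))
        (Finset.mem_univ i)
    have h3 : (D : ℝ) < w i := by
      simp only [w, if_neg hi]
      have : D < ((D.toNat + 1 : ℕ) : ℤ) := by omega
      exact_mod_cast this
    rw [hwS' m0 hm0]
    calc (D : ℝ) < w i := h3
      _ ≤ w i * expSum m i := le_mul_of_one_le_right (Nat.cast_nonneg _) h1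
      _ ≤ _ := h2
  have hwdiff : ∀ m, ∑ i, (e m - e m0) i * w1 i = ∑ i, e m i * w1 i - ∑ i, e m0 i * w1 i :=
    fun m => by simp [sub_mul, Finset.sum_sub_distrib]
  have hle : ∀ m ∈ S, wdeg (fun i => (w i : ℝ)) m0 ≤ wdeg (fun i => (w i : ℝ)) m ∧
      ((m ∈ S' ∧ Bd (e m - e m0)) ↔
        wdeg (fun i => (w i : ℝ)) m ≤ wdeg (fun i => (w i : ℝ)) m0) := by
    intro m hm
    by_cases hm' : m ∈ S'
    · rw [hwS' m hm', hwS' m0 hm0, Int.cast_le, Int.cast_le]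
      have h := hwdiff m
      by_cases hB : Bd (e m - e m0)
      · have := (hyb _ (Finset.mem_filter.mpr ⟨hEm m hm', hB⟩)).1
        exact ⟨by omega, by simp only [hm', hB, true_and, true_iff]; omega⟩
      · have := hyu _ (Finset.mem_filter.mpr ⟨hEm m hm', hB⟩)
        exact ⟨by omega, by simp only [hB, and_false, false_iff]; omega⟩
    · have := hwD m hm hm'
      exact ⟨this.le, by simp [hm', this]⟩
  have hminiff : ∀ m ∈ S,
      (∀ m' ∈ S, wdeg (fun i => (w i : ℝ)) m ≤ wdeg (fun i => (w i : ℝ)) m') ↔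
        (m ∈ S' ∧ Bd (e m - e m0)) := by
    intro m hm
    rw [(hle m hm).2]
    exact ⟨fun h => h m0 (hS'S m0 hm0), fun h m' hm' => h.trans (hle m' hm').1⟩
  -- the rescaled points
  have ha : ∀ i, ∃ c : ℂ, c ≠ 0 ∧
      (i ∈ I → Tendsto (fun p => z p i * (Real.exp (y p i) : ℂ)) 𝓤 (𝓝 c)) := by
    intro i
    by_cases hi : i ∈ I
    -- Since |x_i - y_i| ≤ C, the modulus of z_i e^{y_i} lies in [e^{-C}, e^C]: the limit exists and
    -- is not 0.
    · have hK : IsCompact (Metric.closedBall (0 : ℂ) (Real.exp C) ∩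
          {c : ℂ | Real.exp (-C) ≤ ‖c‖}) :=
        (isCompact_closedBall _ _).inter_right (isClosed_le continuous_const continuous_norm)
      obtain ⟨c, hcK, hc⟩ := 𝓤.exists_tendsto_of_eventually_mem
        (fun p => z p i * (Real.exp (y p i) : ℂ)) hK (by
          filter_upwards [hC, hI i hi] with p hp hp0
          have hn : ‖z p i * (Real.exp (y p i) : ℂ)‖ = Real.exp (-(x p i - y p i)) := by
            rw [norm_mul, Complex.norm_real, Real.norm_of_nonneg (Real.exp_pos _).le, neg_sub,
              sub_eq_add_neg, Real.exp_add, mul_comm]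
            simp only [x, neg_neg]
            rw [Real.exp_log (norm_pos_iff.mpr hp0)]
          have := abs_le.mp (hp i)
          refine ⟨?_, ?_⟩
          · rw [mem_closedBall_zero_iff, hn]
            exact Real.exp_le_exp.mpr (by linarith)
          · change _ ≤ ‖_‖
            rw [hn]
            exact Real.exp_le_exp.mpr (by linarith))
      exact ⟨c, fun h => absurd hcK.2 (by
        rw [h]
        change ¬ _ ≤ ‖_‖
        rw [norm_zero]
        exact not_le.mpr (Real.exp_pos _)), fun _ => hc⟩
    · exact ⟨1, one_ne_zero, fun h => absurd h hi⟩
  choose a ha0 ha1 using ha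
  have hmon : ∀ m ∈ S', Tendsto
      (fun p => mon m (z p) * (Real.exp (∑ i, expSum m i * y p i) : ℂ)) 𝓤
      (𝓝 (mon m (WithLp.toLp 2 a))) := by
    intro m hm
    simp only [← mon_mul_exp]
    refine tendsto_finsetProd _ fun i _ => ?_
    by_cases hi : i ∈ I
    · exact ((ha1 i hi).pow _).mul (((Complex.continuous_conj.tendsto _).comp (ha1 i hi)).pow _)
    · simp [hS'0 m hm i hi]
  -- The scale M is e^{-⟨m0, y⟩}. The quotient of a monomial m by M is its rescaled value times
  -- e^{-⟨m - m0, y⟩}, a factor equal to 1 if m - m0 is bounded and tending to 0 otherwise.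
  refine ⟨w, WithLp.toLp 2 a, fun p => Real.exp (-∑ i, expSum m0 i * y p i),
    fun p => Real.exp_pos _, ha0, fun i hi => ⟨?_, ?_⟩, fun i hi => ?_, fun m hm => ?_⟩
  · simp [w, hz0I i hi, (hb0 i hi).1]
  · refine tendsto_nhds_unique (ha1 i (hz0I i hi)) ?_
    simpa [(hb0 i hi).2] using hzi i
  · by_cases hiI : i ∈ I
    · have := hu0 i hiI hi
      simp only [w, if_pos hiI]
      omega
    · simp [w, hiI]
  have hratio : ∀ p, mon m (z p) / ((Real.exp (-∑ i, expSum m0 i * y p i) : ℝ) : ℂ) =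
      mon m (z p) * (Real.exp (∑ i, expSum m i * y p i) : ℂ) *
        (Real.exp (-∑ i, (((e m - e m0) i : ℤ) : ℝ) * y p i) : ℂ) := by
    intro p
    rw [mul_assoc, ← Complex.ofReal_mul, ← Real.exp_add, hdiff, div_eq_mul_inv,
      ← Complex.ofReal_inv, ← Real.exp_neg]
    congr 3
    ring
  simp only [hratio, hminiff m hm]
  constructor
  · rintro ⟨hm', hB⟩
    have h0 := (hyb _ (Finset.mem_filter.mpr ⟨hEm m hm', hB⟩)).2
    simpa only [h0, neg_zero, Real.exp_zero, Complex.ofReal_one, mul_one] using hmon m hm'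
  · intro hnot
    by_cases hm' : m ∈ S'
    · have hB : ¬ Bd (e m - e m0) := fun h => hnot ⟨hm', h⟩
      have hx := (hdich _ (hEm m hm')).resolve_left hB
      have hytop : Tendsto (fun p => ∑ i, (((e m - e m0) i : ℤ) : ℝ) * y p i) 𝓤 atTop := by
        refine tendsto_atTop_mono' _ ?_ (tendsto_atTop_add_const_right _
          (-∑ i, |(((e m - e m0) i : ℤ) : ℝ)| * C) hx)
        filter_upwards [hC] with p hp
        have h1 : ∑ i, (((e m - e m0) i : ℤ) : ℝ) * (x p i - y p i) ≤
            ∑ i, |(((e m - e m0) i : ℤ) : ℝ)| * C :=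
          Finset.sum_le_sum fun i _ => (le_abs_self _).trans (by
            rw [abs_mul]; exact mul_le_mul_of_nonneg_left (hp i) (abs_nonneg _))
        simp only [mul_sub, Finset.sum_sub_distrib] at h1
        linarith
      have hexp : Tendsto (fun p =>
          (Real.exp (-∑ i, (((e m - e m0) i : ℤ) : ℝ) * y p i) : ℂ)) 𝓤 (𝓝 ((0 : ℝ) : ℂ)) :=
        (Complex.continuous_ofReal.tendsto 0).comp
          (Real.tendsto_exp_neg_atTop_nhds_zero.comp hytop)
      simpa using (hmon m hm').mul hexp
    · obtain ⟨i, hi, hmi⟩ : ∃ i ∉ I, ¬ (m (.inl i) = 0 ∧ m (.inr i) = 0) := by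
        by_contra! H
        exact hm' (Finset.mem_filter.mpr ⟨hm, H⟩)
      refine tendsto_const_nhds.congr' ?_
      filter_upwards [hI' i hi] with p hp
      have : mon m (z p) = 0 := by
        by_contra H
        exact hmi (mon_ne_zero_iff.mp H i hp)
      rw [this, zero_mul, zero_mul]

end MixedPoly

end

/-! ### Limits of tangencies and the zero fibre -/

noncomputable section

namespace MixedPoly

variable {n : ℕ}

lemma wsum_eq_sum_of_subset {f : MixedPoly n} {S : Finset ((Fin n ⊕ Fin n) →₀ ℕ)}
    (h : f.support ⊆ S) (κ : ((Fin n ⊕ Fin n) →₀ ℕ) → ℂ) (z : CSpace (Fin n)) :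
    wsum f κ z = ∑ m ∈ S, f.coeff m * κ m * mon m z :=
  Finset.sum_subset h fun m _ hm => by
    rw [MvPolynomial.notMem_support_iff.mp hm, zero_mul, zero_mul]

open Classical in
lemma coeff_face (f : MixedPoly n) (Δ : Set (Fin n → ℝ)) (m : (Fin n ⊕ Fin n) →₀ ℕ) :
    (f.face Δ).coeff m = if expSum m ∈ Δ then f.coeff m else 0 := by
  simp only [face, MvPolynomial.coeff_sum, MvPolynomial.coeff_monomial, Finset.sum_ite_eq',
    Finset.mem_filter, MvPolynomial.mem_support_iff]
  by_cases h : f.coeff m = 0 <;> simp [h]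

lemma face_support_subset (f : MixedPoly n) (Δ : Set (Fin n → ℝ)) :
    (f.face Δ).support ⊆ f.support := fun m hm => by
  rw [MvPolynomial.mem_support_iff, coeff_face] at hm
  exact MvPolynomial.mem_support_iff.mpr fun h => hm (by simp [h])

lemma continuous_mon (m : (Fin n ⊕ Fin n) →₀ ℕ) : Continuous (mon m) := by
  unfold mon
  fun_prop

/-- Limits of tangencies under rescaling. -/
lemma exists_limit_tangency {X : Type*} (𝓤 : Ultrafilter X) {f : MixedPoly n}
    (g : X → MixedPoly n) (z : X → CSpace (Fin n)) (b : X → ℂ) (s : X → ℝ)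
    (S : Finset ((Fin n ⊕ Fin n) →₀ ℕ)) (hfS : f.support ⊆ S) (hgS : ∀ p, (g p).support ⊆ S)
    (hmin : ∀ (w : Fin n → ℕ) (d : ℝ), (∀ m ∈ f.support, d ≤ wdeg (fun i => (w i : ℝ)) m) →
      ∀ m ∈ S, d ≤ wdeg (fun i => (w i : ℝ)) m)
    (hcoeff : ∀ m, Tendsto (fun p => (g p).coeff m) 𝓤 (𝓝 (f.coeff m)))
    {z0 : CSpace (Fin n)} (hz : Tendsto z 𝓤 (𝓝 z0))
    (hS : ∀ᶠ p in (𝓤 : Filter X), ∃ m ∈ S, mon m (z p) ≠ 0)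
    {b0 : ℂ} (hb : Tendsto b 𝓤 (𝓝 b0))
    (ht : ∀ᶠ p in (𝓤 : Filter X), IsTangency (g p) (b p) (s p) (z p)) :
    ∃ (w : Fin n → ℕ) (a : CSpace (Fin n)) (M : X → ℝ) (γ : Fin n → ℝ),
      (∀ p, 0 < M p) ∧ (∀ i, a i ≠ 0) ∧
      (∀ i, z0 i ≠ 0 → w i = 0 ∧ a i = z0 i) ∧ (∀ i, z0 i = 0 → 0 < w i) ∧
      (∀ i, Tendsto (fun p => s p * ‖z p i‖ ^ 2 / M p) 𝓤 (𝓝 (γ i))) ∧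
      (∀ i c, (starRingEnd ℂ b0 * wsum (f.face (f.weightFace w)) (logWeight i c) a).re
        = c.re * γ i) ∧
      Tendsto (fun p => (g p).toFun (z p) / (M p : ℂ)) 𝓤
        (𝓝 ((f.face (f.weightFace w)).toFun a)) := by
  obtain ⟨w, a, M, hM, ha, hw0, hw1, hlim⟩ := exists_dominant_weight 𝓤 z z0 hz S hS
  have hW : ∀ κ, Tendsto (fun p => wsum (g p) κ (z p) / (M p : ℂ)) 𝓤
      (𝓝 (wsum (f.face (f.weightFace w)) κ a)) := by
    intro κ
    rw [wsum_eq_sum_of_subset ((face_support_subset _ _).trans hfS)]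
    simp only [fun p => wsum_eq_sum_of_subset (hgS p) κ (z p), Finset.sum_div]
    refine tendsto_finsetSum _ fun m hm => ?_
    simp only [mul_div_assoc]
    have hcm := (hcoeff m).mul (tendsto_const_nhds (x := κ m))
    by_cases hmf : m ∈ f.support
    · rw [coeff_face]
      by_cases hmΔ : expSum m ∈ f.weightFace w
      · rw [if_pos hmΔ]
        refine hcm.mul ((hlim m hm).1 ?_)
        exact hmin w _ ((expSum_mem_weightFace_iff hmf).mp hmΔ)
      · rw [if_neg hmΔ, zero_mul, zero_mul]
        have := hcm.mul ((hlim m hm).2 fun H => hmΔ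
          ((expSum_mem_weightFace_iff hmf).mpr fun m' hm' => H m' (hfS hm')))
        rwa [mul_zero] at this
    -- The coefficient of such a term tends to 0, while its monomial divided by M converges even
    -- when it has least weight.
    · have h0 := MvPolynomial.notMem_support_iff.mp hmf
      rw [coeff_face, h0, ite_self, zero_mul, zero_mul]
      rw [h0, zero_mul] at hcm
      by_cases hmm : ∀ m' ∈ S, wdeg (fun i => (w i : ℝ)) m ≤ wdeg (fun i => (w i : ℝ)) m'
      · simpa using hcm.mul ((hlim m hm).1 hmm)
      · simpa using hcm.mul ((hlim m hm).2 hmm)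
  -- No bound on s is available; the tangency equation itself makes s|z_i|²/M converge.
  have hre : ∀ i c, Tendsto (fun p => c.re * (s p * ‖z p i‖ ^ 2 / M p)) 𝓤
      (𝓝 (starRingEnd ℂ b0 * wsum (f.face (f.weightFace w)) (logWeight i c) a).re) := by
    intro i c
    refine ((Complex.continuous_re.tendsto _).comp
      (((Complex.continuous_conj.tendsto _).comp hb).mul (hW (logWeight i c)))).congr' ?_
    filter_upwards [ht] with p hp
    simp only [Function.comp_apply]
    rw [← mul_div_assoc, Complex.div_ofReal_re, hp.eq]
    ring
  have hγ : ∀ i, Tendsto (fun p => s p * ‖z p i‖ ^ 2 / M p) 𝓤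
      (𝓝 (starRingEnd ℂ b0 * wsum (f.face (f.weightFace w)) (logWeight i 1) a).re) := fun i => by
    simpa using hre i 1
  refine ⟨w, a, M, _, hM, ha, hw0, hw1, hγ, fun i c => ?_, ?_⟩
  · exact tendsto_nhds_unique (hre i c) ((hγ i).const_mul c.re)
  · simpa only [toFun_eq_wsum] using hW fun _ => 1

lemma exists_mon_ne_zero {f : MixedPoly n} {z : CSpace (Fin n)} (h : f.toFun z ≠ 0) :
    ∃ m ∈ f.support, mon m z ≠ 0 := by
  by_contra! H
  exact h (by rw [eval_eq_sum_mon]; exact Finset.sum_eq_zero fun m hm => by rw [H m hm, mul_zero])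

/-- The Euler identity for the face function of a weight. -/
lemma sum_weight_mul_wsum_face {f : MixedPoly n} (hf : f.support.Nonempty) (w : Fin n → ℕ) :
    ∃ d : ℝ, ∀ a : CSpace (Fin n),
      ∑ i, (w i : ℂ) * wsum (f.face (f.weightFace w)) (logWeight i 1) a =
        d * (f.face (f.weightFace w)).toFun a := by
  obtain ⟨m0, hm0, hmin⟩ := exists_minimal_support hf (fun i => (w i : ℝ))
  refine ⟨wdeg (fun i => (w i : ℝ)) m0, fun a => ?_⟩
  rw [toFun_eq_wsum]
  simp only [wsum, Finset.mul_sum]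
  rw [Finset.sum_comm]
  refine Finset.sum_congr rfl fun m hm => ?_
  have hmf := face_support_subset _ _ hm
  have hmΔ : expSum m ∈ f.weightFace w := by
    by_contra H
    rw [MvPolynomial.mem_support_iff, coeff_face, if_neg H] at hm
    exact hm rfl
  have hd : wdeg (fun i => (w i : ℝ)) m0 = wdeg (fun i => (w i : ℝ)) m :=
    le_antisymm (hmin m hmf) ((expSum_mem_weightFace_iff hmf).mp hmΔ m0 hm0)
  rw [hd, wdeg, Complex.ofReal_sum, Finset.sum_mul]
  refine Finset.sum_congr rfl fun i _ => ?_
  simp only [logWeight, expSum, map_one]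
  push_cast
  ring

/-- A positive weight cuts out a compact face, where strong non-degeneracy applies. -/
lemma not_forall_re_eq_zero_of_pos {f : MixedPoly n} (hf : f.support.Nonempty)
    (hnd : f.StronglyNonDegenerate) {w : Fin n → ℕ} (hw : ∀ i, 0 < w i) {a : CSpace (Fin n)}
    (ha : ∀ i, a i ≠ 0) {b : ℂ} (hb : b ≠ 0) :
    ¬ ∀ i c, (starRingEnd ℂ b * wsum (f.face (f.weightFace w)) (logWeight i c) a).re = 0 :=
  fun h => hnd _ (isCompactFace_of_pos hf (w := fun i => (w i : ℝ))
    (fun i => Nat.cast_pos.mpr (hw i))) a ha (isMixedCritical_of_wsum ha hb h)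

/-- Near the origin, the zero fibre is non-singular and transverse to the spheres along each
coordinate torus on which `f` does not vanish identically. -/
lemma eventually_no_tangency_of_toFun_eq_zero {f : MixedPoly n} (hf : f.support.Nonempty)
    (hnd : f.StronglyNonDegenerate) :
    ∀ᶠ z in 𝓝 (0 : CSpace (Fin n)), ∀ b s, IsTangency f b s z → f.toFun z = 0 →
      ¬ ∃ m ∈ f.support, mon m z ≠ 0 := by
  let Bad : Set (CSpace (Fin n) × ℂ × ℝ) := {p | IsTangency f p.2.1 p.2.2 p.1 ∧
    f.toFun p.1 = 0 ∧ ∃ m ∈ f.support, mon m p.1 ≠ 0}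
  -- The comap filter constrains z only, so one contradiction handles all multipliers b and s.
  suffices h : ∀ᶠ p in comap (fun p : CSpace (Fin n) × ℂ × ℝ => p.1) (𝓝 0), p ∉ Bad from
    (eventually_comap.mp h).mono fun z hz b s h1 h2 h3 => hz (z, b, s) rfl ⟨h1, h2, h3⟩
  by_contra hcon
  have hfreq : ∃ᶠ p in comap (fun p : CSpace (Fin n) × ℂ × ℝ => p.1) (𝓝 0), p ∈ Bad := hcon
  have := frequently_mem_iff_neBot.mp hfreq
  let 𝓤 := Ultrafilter.of
    (comap (fun p : CSpace (Fin n) × ℂ × ℝ => p.1) (𝓝 0) ⊓ 𝓟 Bad)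
  have h𝓤 := Ultrafilter.of_le
    (comap (fun p : CSpace (Fin n) × ℂ × ℝ => p.1) (𝓝 0) ⊓ 𝓟 Bad)
  have hz : Tendsto (fun p : CSpace (Fin n) × ℂ × ℝ => p.1) 𝓤 (𝓝 0) :=
    tendsto_comap.mono_left (h𝓤.trans inf_le_left)
  have hbad : ∀ᶠ p in (𝓤 : Filter _), p ∈ Bad := le_principal_iff.mp (h𝓤.trans inf_le_right)
  obtain ⟨b0, hb0, hb⟩ := 𝓤.exists_tendsto_of_eventually_mem
    (fun p : CSpace (Fin n) × ℂ × ℝ => p.2.1) (isCompact_sphere (0 : ℂ) 1)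
    (hbad.mono fun p hp => mem_sphere_zero_iff_norm.mpr hp.1.norm_eq)
  have hb0' : b0 ≠ 0 := by
    rintro rfl
    simp at hb0
  obtain ⟨w, a, M, γ, hM, ha, -, hw, hγ, hre, hval⟩ := exists_limit_tangency 𝓤 (f := f)
    (fun _ => f) _ _ (fun p => p.2.2) f.support subset_rfl (fun _ => subset_rfl)
    (fun _ _ h => h) (fun _ => tendsto_const_nhds) hz (hbad.mono fun p hp => hp.2.2) hb
    (hbad.mono fun p hp => hp.1)
  have hval0 : (f.face (f.weightFace w)).toFun a = 0 := by
    refine tendsto_nhds_unique hval (tendsto_const_nhds.congr' ?_)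
    filter_upwards [hbad] with p hp
    rw [hp.2.1, zero_div]
  have hγ0 : ∀ i, 0 ≤ γ i := fun i => ge_of_tendsto (hγ i) (by
    filter_upwards [hbad] with p hp
    have h1 := hM p
    have h2 := hp.1.nonneg
    positivity)
  -- By Euler's identity the sum is Re(b̄0 d f_Δ(a)), and f_Δ(a) = 0 as a limit of zeros. With γ_i ≥
  -- 0 and w_i > 0 every γ_i vanishes.
  have hsum : ∑ i, (w i : ℝ) * γ i = 0 := by
    obtain ⟨d, hd⟩ := sum_weight_mul_wsum_face hf w
    have h1 := hd a
    rw [hval0, mul_zero] at h1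
    have h2 : starRingEnd ℂ b0 *
        ∑ i, (w i : ℂ) * wsum (f.face (f.weightFace w)) (logWeight i 1) a = 0 := by
      rw [h1, mul_zero]
    have h3 := congrArg Complex.re h2
    rw [Finset.mul_sum, Complex.re_sum, Complex.zero_re] at h3
    rw [← h3]
    refine Finset.sum_congr rfl fun i _ => ?_
    rw [mul_left_comm, ← Complex.ofReal_natCast, Complex.re_ofReal_mul, hre]
    simp
  have hγz : ∀ i, γ i = 0 := fun i => by
    have := (Finset.sum_eq_zero_iff_of_nonneg
      (fun i _ => mul_nonneg (Nat.cast_nonneg (w i)) (hγ0 i))).mp hsum i (Finset.mem_univ i)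
    exact (mul_eq_zero.mp this).resolve_left (Nat.cast_ne_zero.mpr (hw i rfl).ne')
  exact not_forall_re_eq_zero_of_pos hf hnd (fun i => hw i rfl) ha hb0' fun i c => by
    rw [hre, hγz, mul_zero]

/-- The radius of local tameness can be chosen independently of the face. -/
lemma LocallyTame.eventually_not_isCriticalOff {f : MixedPoly n} (h : f.LocallyTame) :
    ∀ᶠ R in 𝓝[>] (0 : ℝ), ∀ w : Fin n → ℕ, f.IsEssentialFace (f.weightFace w) w →
      ∀ z : CSpace (Fin n), (∀ i, z i ≠ 0) → ∑ i ∈ zeroSet w, ‖z i‖ ^ 2 ≤ R ^ 2 →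
        ¬ (f.face (f.weightFace w)).IsCriticalOff (zeroSet w) z := by
  classical
  -- There are infinitely many weights, but the statement depends only on the monomials of f on the
  -- face and on the zero set: finitely many pairs, hence a common radius.
  have key : ∀ q : {T // T ∈ f.support.powerset} × Finset (Fin n),
      ∀ᶠ R in 𝓝[>] (0 : ℝ), ∀ w : Fin n → ℕ,
        f.support.filter (fun m => expSum m ∈ f.weightFace w) = q.1.1 → zeroSet w = q.2 →
        f.IsEssentialFace (f.weightFace w) w →
        ∀ z : CSpace (Fin n), (∀ i, z i ≠ 0) → ∑ i ∈ zeroSet w, ‖z i‖ ^ 2 ≤ R ^ 2 →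
          ¬ (f.face (f.weightFace w)).IsCriticalOff (zeroSet w) z := by
    rintro ⟨⟨T, hT⟩, I⟩
    by_cases hex : ∃ w : Fin n → ℕ, f.support.filter (fun m => expSum m ∈ f.weightFace w) = T ∧
        zeroSet w = I ∧ f.IsEssentialFace (f.weightFace w) w
    · obtain ⟨w, hwT, hwI, hess⟩ := hex
      obtain ⟨ρ, hρ, htame⟩ := h I (hwI ▸ hess.vanishes) _ w hess hwI
      filter_upwards [Ioo_mem_nhdsGT hρ] with R hR w' hw'T hw'I _ z hz hsum
      have hface : f.face (f.weightFace w') = f.face (f.weightFace w) := by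
        simp only [face]
        convert rfl using 2
        exact hwT.trans hw'T.symm
      rw [hw'I] at hsum ⊢
      rw [hface]
      exact htame z hz (hsum.trans_lt (pow_lt_pow_left₀ hR.2 hR.1.le two_ne_zero))
    · exact Eventually.of_forall fun R w h1 h2 h3 => absurd ⟨w, h1, h2, h3⟩ hex
  filter_upwards [eventually_all.mpr key] with R hR w hess z hz hsum
  exact hR (⟨_, Finset.mem_powerset.mpr (Finset.filter_subset _ _)⟩, zeroSet w) w rfl rfl hess z
    hz hsum

end MixedPoly

/-! ### Families: absence of tangencies on nearby fibres -/

namespace MixedFamily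

open MixedPoly

variable {n : ℕ}

lemma coeff_at (F : MixedFamily n) (t : ℂ) (m : (Fin n ⊕ Fin n) →₀ ℕ) :
    (F.at t).coeff m = (F.coeff m).eval t := by
  simp [MixedFamily.at, MvPolynomial.coeff_map]

lemma support_at_subset (F : MixedFamily n) (t : ℂ) : (F.at t).support ⊆ F.support :=
  MvPolynomial.support_map_subset _ _

/-- Each of the finitely many non-zero coefficient polynomials has finitely many roots. -/
lemma eventually_support_subset (F : MixedFamily n) :
    ∀ᶠ t in 𝓝[≠] (0 : ℂ), F.support ⊆ (F.at t).support := by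
  have : ∀ m ∈ F.support, ∀ᶠ t in 𝓝[≠] (0 : ℂ), (F.coeff m).eval t ≠ 0 := fun m hm =>
    nhdsNE_le_cofinite 0 (Polynomial.finite_setOfPred_isRoot
      (MvPolynomial.mem_support_iff.mp hm)).compl_mem_cofinite
  filter_upwards [(Finset.eventually_all F.support).mpr this] with t ht m hm
  rw [MvPolynomial.mem_support_iff, coeff_at]
  exact ht m hm

/-- Constancy of the Newton boundary enters here: a monomial whose coefficient vanishes at t = 0
occurs in f_t for nearby t ≠ 0, so its weight is not below the minimum for f_0. -/
lemma le_wdeg_of_newtonBoundary_eq {F : MixedFamily n}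
    (hnewton : ∀ᶠ t in 𝓝 (0 : ℂ), (F.at t).newtonBoundary = (F.at 0).newtonBoundary)
    (w : Fin n → ℕ) (d : ℝ) (hd : ∀ m ∈ (F.at 0).support, d ≤ wdeg (fun i => (w i : ℝ)) m) :
    ∀ m ∈ F.support, d ≤ wdeg (fun i => (w i : ℝ)) m := by
  obtain ⟨t, h1, h2⟩ :=
    (F.eventually_support_subset.and (hnewton.filter_mono nhdsWithin_le_nhds)).exists
  exact fun m hm => le_wdeg_of_newtonBoundary_subset h2.le (fun i => Nat.cast_nonneg _) hd (h1 hm)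

lemma tendsto_wsum_at {X : Type*} {l : Filter X} (F : MixedFamily n) {t : X → ℂ} {t0 : ℂ}
    (ht : Tendsto t l (𝓝 t0)) {z : X → CSpace (Fin n)} {z0 : CSpace (Fin n)}
    (hz : Tendsto z l (𝓝 z0)) (κ : ((Fin n ⊕ Fin n) →₀ ℕ) → ℂ) :
    Tendsto (fun p => wsum (F.at (t p)) κ (z p)) l (𝓝 (wsum (F.at t0) κ z0)) := by
  simp only [fun t z => wsum_eq_sum_of_subset (F.support_at_subset t) κ z, coeff_at]
  exact tendsto_finsetSum _ fun m _ =>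
    ((((F.coeff m).continuous.tendsto t0).comp ht).mul tendsto_const_nhds).mul
      (((continuous_mon m).tendsto z0).comp hz)

/-- Tangency is a closed condition away from the origin: a coordinate with z0_j ≠ 0 lets s be solved
from its equation with c = 1, so s converges. -/
lemma isTangency_of_tendsto {X : Type*} {l : Filter X} [l.NeBot] (F : MixedFamily n) {t : X → ℂ}
    {t0 : ℂ} (ht : Tendsto t l (𝓝 t0)) {z : X → CSpace (Fin n)} {z0 : CSpace (Fin n)}
    (hz : Tendsto z l (𝓝 z0)) (hz0 : z0 ≠ 0) {b : X → ℂ} {b0 : ℂ} (hb : Tendsto b l (𝓝 b0))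
    {s : X → ℝ} (h : ∀ᶠ p in l, IsTangency (F.at (t p)) (b p) (s p) (z p)) :
    ∃ s0, IsTangency (F.at t0) b0 s0 z0 := by
  have hzi : ∀ i, Tendsto (fun p => z p i) l (𝓝 (z0 i)) := fun i =>
    ((EuclideanSpace.proj i : CSpace (Fin n) →L[ℂ] ℂ).continuous.tendsto z0).comp hz
  have hre : ∀ i c, Tendsto (fun p => s p * c.re * ‖z p i‖ ^ 2) l
      (𝓝 (starRingEnd ℂ b0 * wsum (F.at t0) (logWeight i c) z0).re) := by
    intro i c
    refine ((Complex.continuous_re.tendsto _).comp (((Complex.continuous_conj.tendsto _).comp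
      hb).mul (F.tendsto_wsum_at ht hz (logWeight i c)))).congr' ?_
    filter_upwards [h] with p hp
    exact hp.eq i c
  obtain ⟨j, hj⟩ : ∃ j, z0 j ≠ 0 := by
    by_contra! H
    exact hz0 (PiLp.ext H)
  obtain ⟨s0, hs⟩ : ∃ s0, Tendsto s l (𝓝 s0) := by
    refine ⟨_, ((hre j 1).div ((hzi j).norm.pow 2)
      (pow_ne_zero 2 (norm_ne_zero_iff.mpr hj))).congr' ?_⟩
    filter_upwards [(hzi j).eventually_ne hj] with p hp
    have : ‖z p j‖ ≠ 0 := norm_ne_zero_iff.mpr hp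
    simp only [Pi.div_apply, Complex.one_re]
    field_simp
  refine ⟨s0, ?_, ge_of_tendsto hs (h.mono fun p hp => hp.nonneg), fun i c => ?_⟩
  · exact tendsto_nhds_unique hb.norm (tendsto_const_nhds.congr' (h.mono fun p hp =>
      hp.norm_eq.symm))
  · exact tendsto_nhds_unique (hre i c) ((hs.mul_const c.re).mul ((hzi i).norm.pow 2))

/-- In a fixed ball, the fibres of the members of the family over small non-zero values have no
critical points, and away from the origin no tangencies with the spheres. -/
lemma eventually_no_tangency {F : MixedFamily n} (hf : (F.at 0).support.Nonempty)
    (hnewton : ∀ᶠ t in 𝓝 (0 : ℂ), (F.at t).newtonBoundary = (F.at 0).newtonBoundary)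
    (hnd : (F.at 0).StronglyNonDegenerate) {R r : ℝ} (hr : 0 < r)
    (hzero : ∀ z : CSpace (Fin n), ‖z‖ ≤ R → ∀ b s, IsTangency (F.at 0) b s z →
      (F.at 0).toFun z = 0 → ¬ ∃ m ∈ (F.at 0).support, mon m z ≠ 0)
    (htame : ∀ w : Fin n → ℕ, (F.at 0).IsEssentialFace ((F.at 0).weightFace w) w →
      ∀ z : CSpace (Fin n), (∀ i, z i ≠ 0) → ∑ i ∈ zeroSet w, ‖z i‖ ^ 2 ≤ R ^ 2 →
        ¬ ((F.at 0).face ((F.at 0).weightFace w)).IsCriticalOff (zeroSet w) z) :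
    ∀ᶠ q : ℂ × ℂ in 𝓝 0 ×ˢ 𝓝 0, ∀ z b s, ‖z‖ ≤ R → (s = 0 ∨ r ≤ ‖z‖) →
      (F.at q.1).toFun z = q.2 → q.2 ≠ 0 → ¬ IsTangency (F.at q.1) b s z := by
  let Y := ℂ × CSpace (Fin n) × ℂ × ℝ
  let φ : Y → ℂ × ℂ := fun p => (p.1, (F.at p.1).toFun p.2.1)
  let Bad : Set Y := {p | ‖p.2.1‖ ≤ R ∧ (p.2.2.2 = 0 ∨ r ≤ ‖p.2.1‖) ∧
    (F.at p.1).toFun p.2.1 ≠ 0 ∧ IsTangency (F.at p.1) p.2.2.1 p.2.2.2 p.2.1}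
  suffices h : ∀ᶠ p in comap φ (𝓝 0 ×ˢ 𝓝 0), p ∉ Bad from
    (eventually_comap.mp h).mono fun q hq z b s h1 h2 h3 h4 h5 =>
      hq (q.1, z, b, s) (Prod.ext rfl h3) ⟨h1, h2, h3 ▸ h4, h5⟩
  by_contra hcon
  have hfreq : ∃ᶠ p in comap φ (𝓝 0 ×ˢ 𝓝 0), p ∈ Bad := hcon
  have := frequently_mem_iff_neBot.mp hfreq
  let 𝓤 := Ultrafilter.of (comap φ (𝓝 0 ×ˢ 𝓝 0) ⊓ 𝓟 Bad)
  have h𝓤 := Ultrafilter.of_le (comap φ (𝓝 0 ×ˢ 𝓝 0) ⊓ 𝓟 Bad)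
  have hφ : Tendsto φ 𝓤 (𝓝 0 ×ˢ 𝓝 0) := tendsto_comap.mono_left (h𝓤.trans inf_le_left)
  have ht : Tendsto (fun p : Y => p.1) 𝓤 (𝓝 0) := (tendsto_fst (f := 𝓝 (0 : ℂ)) (g := 𝓝 (0 : ℂ))).comp hφ
  have hη : Tendsto (fun p : Y => (F.at p.1).toFun p.2.1) 𝓤 (𝓝 0) :=
    (tendsto_snd (f := 𝓝 (0 : ℂ)) (g := 𝓝 (0 : ℂ))).comp hφ
  have hbad : ∀ᶠ p in (𝓤 : Filter Y), p ∈ Bad := le_principal_iff.mp (h𝓤.trans inf_le_right)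
  have htan : ∀ᶠ p : Y in (𝓤 : Filter Y), IsTangency (F.at p.1) p.2.2.1 p.2.2.2 p.2.1 :=
    hbad.mono fun p hp => hp.2.2.2
  obtain ⟨b0, hb0, hb⟩ := 𝓤.exists_tendsto_of_eventually_mem
    (fun p : Y => p.2.2.1) (isCompact_sphere (0 : ℂ) 1)
    (htan.mono fun p hp => mem_sphere_zero_iff_norm.mpr hp.norm_eq)
  have hb0' : b0 ≠ 0 := by
    rintro rfl
    simp at hb0
  obtain ⟨z0, hz0, hz⟩ := 𝓤.exists_tendsto_of_eventually_mem
    (fun p : Y => p.2.1) (isCompact_closedBall (0 : CSpace (Fin n)) R)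
    (hbad.mono fun p hp => mem_closedBall_zero_iff.mpr hp.1)
  rw [mem_closedBall_zero_iff] at hz0
  obtain ⟨w, a, M, γ, hM, ha, hw0, hw1, hγ, hre, -⟩ := exists_limit_tangency 𝓤 (f := F.at 0)
    (fun p => F.at p.1) _ _ (fun p => p.2.2.2) F.support (F.support_at_subset 0)
    (fun p => F.support_at_subset p.1) (le_wdeg_of_newtonBoundary_eq hnewton)
    (fun m => by
      simp only [coeff_at]
      exact ((F.coeff m).continuous.tendsto 0).comp ht)
    hz (hbad.mono fun p hp => by
      obtain ⟨m, hm, h⟩ := exists_mon_ne_zero hp.2.2.1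
      exact ⟨m, F.support_at_subset _ hm, h⟩) hb htan
  have hzi : ∀ i, Tendsto (fun p : Y => p.2.1 i) 𝓤 (𝓝 (z0 i)) := fun i =>
    ((EuclideanSpace.proj i : CSpace (Fin n) →L[ℂ] ℂ).continuous.tendsto z0).comp hz
  by_cases hz00 : z0 = 0
  · subst hz00
    -- Points with ‖z‖ < r are bad only as critical points, that is with s = 0.
    have hs0 : ∀ᶠ p : Y in (𝓤 : Filter Y), p.2.2.2 = 0 := by
      have hlt : ∀ᶠ p : Y in (𝓤 : Filter Y), ‖p.2.1‖ < r :=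
        hz.norm.eventually_lt_const (by simpa using hr)
      filter_upwards [hbad, hlt] with p hp hlt
      exact hp.2.1.resolve_right (not_le.mpr hlt)
    have hγ0 : ∀ i, γ i = 0 := fun i =>
      tendsto_nhds_unique (hγ i) (tendsto_const_nhds.congr' (hs0.mono fun p hp => by simp [hp]))
    exact not_forall_re_eq_zero_of_pos hf hnd (fun i => hw1 i rfl) ha hb0' fun i c => by
      rw [hre, hγ0, mul_zero]
  obtain ⟨j, hj⟩ : ∃ j, z0 j ≠ 0 := by
    by_contra! H
    exact hz00 (PiLp.ext H)
  by_cases hmon : ∃ m ∈ (F.at 0).support, mon m z0 ≠ 0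
  · obtain ⟨s0, hs0⟩ := F.isTangency_of_tendsto ht hz hz00 hb htan
    refine hzero z0 hz0 b0 s0 hs0 ?_ hmon
    simp only [toFun_eq_wsum] at hη ⊢
    exact tendsto_nhds_unique (F.tendsto_wsum_at ht hz _) hη
  · push Not at hmon
    have hess : (F.at 0).IsEssentialFace ((F.at 0).weightFace w) w := by
      refine isEssentialFace_weightFace hf ⟨j, (hw0 j hj).1⟩ fun m hm => ?_
      by_contra! H
      refine (mon_ne_zero_iff.mpr fun i hi => ?_) (hmon m hm)
      exact H i (hw1 i hi).ne'
    -- On I_w the coordinates of a are those of z0, which lies in the ball of radius R.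
    have hsum : ∑ i ∈ zeroSet w, ‖a i‖ ^ 2 ≤ R ^ 2 := by
      calc ∑ i ∈ zeroSet w, ‖a i‖ ^ 2 = ∑ i ∈ zeroSet w, ‖z0 i‖ ^ 2 := by
            refine Finset.sum_congr rfl fun i hi => ?_
            have hwi : w i = 0 := by simpa [zeroSet] using hi
            rw [(hw0 i fun h => (hw1 i h).ne' hwi).2]
        _ ≤ ∑ i, ‖z0 i‖ ^ 2 := Finset.sum_le_univ_sum_of_nonneg fun i => sq_nonneg _
        _ = ‖z0‖ ^ 2 := (EuclideanSpace.norm_sq_eq z0).symm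
        _ ≤ R ^ 2 := pow_le_pow_left₀ (norm_nonneg _) hz0 2
    refine htame w hess a ha hsum (isCriticalOff_of_wsum ha hb0' fun i hi c => ?_)
    have hwi : w i ≠ 0 := by simpa [zeroSet] using hi
    have hzi0 : z0 i = 0 := by_contra fun h => hwi (hw0 i h).1
    -- Comparison with j: s|z_i|²/M = (s|z_j|²/M)(|z_i|/|z_j|)², where the first factor converges
    -- and the second tends to 0.
    have hlim : Tendsto (fun p : Y => (p.2.2.2 * ‖p.2.1 j‖ ^ 2 / M p) / ‖p.2.1 j‖ ^ 2 *
        ‖p.2.1 i‖ ^ 2) 𝓤 (𝓝 (γ j / ‖z0 j‖ ^ 2 * ‖z0 i‖ ^ 2)) :=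
      ((hγ j).div ((hzi j).norm.pow 2) (pow_ne_zero 2 (norm_ne_zero_iff.mpr hj))).mul
        ((hzi i).norm.pow 2)
    have hγi : γ i = γ j / ‖z0 j‖ ^ 2 * ‖z0 i‖ ^ 2 := by
      refine tendsto_nhds_unique (hγ i) (hlim.congr' ?_)
      filter_upwards [(hzi j).eventually_ne hj] with p hp
      have : ‖p.2.1 j‖ ≠ 0 := norm_ne_zero_iff.mpr hp
      field_simp
    rw [hre, hγi, hzi0]
    simp

end MixedFamily

end

/-! ### Choice of the radii -/

theorem proposition3p3 (n : ℕ) (F : MixedFamily n)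
    (hzero : ∀ᶠ t in 𝓝 (0 : ℂ), (F.at t).toFun 0 = 0)
    (hne : ∀ᶠ t in 𝓝 (0 : ℂ), ¬ ∀ᶠ z in 𝓝 (0 : CSpace (Fin n)), (F.at t).toFun z = 0)
    (hnewton : ∀ᶠ t in 𝓝 (0 : ℂ), (F.at t).newtonBoundary = (F.at 0).newtonBoundary)
    (hnondeg : ∀ᶠ t in 𝓝 (0 : ℂ), (F.at t).StronglyNonDegenerate ∧ (F.at t).LocallyTame) :
    ∃ R' : ℝ, 0 < R' ∧ ∀ R'' : ℝ, 0 < R'' → R'' ≤ R' →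
      ∃ δ : ℝ, 0 < δ ∧ ∀ᶠ t in 𝓝 (0 : ℂ),
        ∀ η : ℂ, η ≠ 0 → ‖η‖ ≤ δ →
          (F.at t).FibreNonSingular η (Metric.ball 0 R') ∧
          ∀ r : ℝ, R'' ≤ r → r ≤ R' →
            (F.at t).FibreTransverseToSphere η (Metric.ball 0 R') r := by
  obtain ⟨hnd, htame⟩ := hnondeg.self_of_nhds
  have hf : (F.at 0).support.Nonempty := by
    rw [Finset.nonempty_iff_ne_empty]
    intro h
    refine hne.self_of_nhds (Eventually.of_forall fun z => ?_)
    rw [MixedPoly.eval_eq_sum_mon, h, Finset.sum_empty]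
  obtain ⟨ε, hε, hball⟩ := Metric.eventually_nhds_iff.mp
    (MixedPoly.eventually_no_tangency_of_toFun_eq_zero hf hnd)
  -- R is a radius of local tameness for all essential faces of f_0, and lies inside the ball where
  -- its zero fibre is controlled.
  obtain ⟨R, hR, hRε⟩ := (htame.eventually_not_isCriticalOff.and (Ioo_mem_nhdsGT hε)).exists
  refine ⟨R, hRε.1, fun r hr _ => ?_⟩
  have key := MixedFamily.eventually_no_tangency hf hnewton hnd hr
    (fun z hz => hball (by rw [dist_zero_right]; exact hz.trans_lt hRε.2)) hR
  obtain ⟨P, hP, Q, hQ, hPQ⟩ := eventually_prod_iff.mp key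
  obtain ⟨δ, hδ, hQδ⟩ := Metric.eventually_nhds_iff.mp hQ
  -- Halving passes from the open disc of radius δ to the condition ‖η‖ ≤ δ / 2.
  refine ⟨δ / 2, half_pos hδ, hP.mono fun t ht η hη0 hη => ?_⟩
  have hno := hPQ ht (hQδ (show dist η 0 < δ by rw [dist_zero_right]; linarith))
  refine ⟨fun z hz hcrit => ?_, fun r' hr' _ z hz => ?_⟩
  · obtain ⟨b, hb⟩ := MixedPoly.exists_isTangency_of_isMixedCritical hcrit
    exact hno z b 0 (mem_ball_zero_iff.mp hz.2).le (Or.inl rfl) hz.1 hη0 hb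
  · by_contra hcon
    have hzr : ‖z‖ = r' := mem_sphere_zero_iff_norm.mp hz.2
    have hz0 : z ≠ 0 := norm_pos_iff.mp (by rw [hzr]; exact hr.trans_le hr')
    obtain ⟨b, s, hb⟩ := MixedPoly.exists_isTangency_of_not_transverse hz0 hcon
    exact hno z b s (mem_ball_zero_iff.mp hz.1.2).le (Or.inr (hr'.trans hzr.ge)) hz.1.1 hη0 hb
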